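/- Proposition (Ising model). For every $\alpha\in\mathbb{R}$ and $\rho>0$ there is a constant $C=C(\alpha,\rho)>0$ such that the following holds. Let $n\ge 0$, let $J=(J_{ij})_{i,j=1}^n$ be a real symmetric matrix with zero diagonal, let $\mathbf{h}\in\mathbb{R}^n$, and suppose that $\|\mathbf{h}\|_\infty\le\alpha$ and that Dobrushin's condition $$\|J\|_{1\to1}=\max_{i=1,\dots,n}\sum_{j=1}^n|J_{ij}|\le 1-\rho$$ holds. Let $\sigma$ be a random vector in $\{-1,1\}^n$ distributed according to the Ising model $$\pi(\sigma)=\frac1{Z'}\exp\Bigl(\frac12\sum_{i,j=1}^nJ_{ij}\sigma_i\sigma_j-\sum_{i=1}^nh_i\sigma_i\Bigr),$$ where $Z'$ is the normalizing factor. Let $\mathcal{A}$ be a finite nonempty set of real symmetric $n\times n$ matrices with zero diagonal. Then for every $t\ge0$ $$\mathbb{P}\Bigl(\sup_{A\in\mathcal{A}}\sigma^\top A\sigma-\mathbb{E}\sup_{A\in\mathcal{A}}\sigma^\top A\sigma\ge t\Bigr)\le\exp\left(-C\min\left(\frac{t^2}{\bigl(\mathbb{E}\sup_{A\in\mathcal{A}}\|A\sigma\|+\sup_{A\in\mathcal{A}}\|A\|\bigr)^2},\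 \frac{t}{\sup_{A\in\mathcal{A}}\|A\|}\right)\right),$$ where $\|A\sigma\|$ is the Euclidean norm and $\|A\|$ is the operator norm with respect to the Euclidean norm. (If $n=0$, the maximum over $i$ is read as $0$. In the degenerate case where all $A\in\mathcal{A}$ vanish, a fraction with denominator $0$ is read as $0$.) -/

import Mathlib

open scoped BigOperators Matrix

namespace Ising

/-- The configuration space `{-1, 1} ^ n`. -/
abbrev Config (n : ℕ) : Type := Fin n → ℤˣ

/-- A configuration seen as a vector of real numbers `1` and `-1`. -/
def spin {n : ℕ} (σ : Config n) : Fin n → ℝ := fun i => ((σ i : ℤ) : ℝ)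

/-- The unnormalized weight `exp (1/2 * ∑ i j, J i j σ i σ j - ∑ i, h i σ i)`. For symmetric `J`
with zero diagonal, the interaction term is `∑ i < j, J i j σ i σ j`. -/
noncomputable def weight {n : ℕ} (J : Matrix (Fin n) (Fin n) ℝ) (h : Fin n → ℝ)
    (σ : Config n) : ℝ :=
  Real.exp ((1 / 2 : ℝ) * ∑ i, ∑ j, J i j * spin σ i * spin σ j - ∑ i, h i * spin σ i)

/-- The normalizing factor. -/
noncomputable def partitionFunction {n : ℕ} (J : Matrix (Fin n) (Fin n) ℝ) (h : Fin n → ℝ) : ℝ :=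
  ∑ σ : Config n, weight J h σ

/-- The probability mass of a configuration in the Ising model with parameters `J` and `h`. -/
noncomputable def mass {n : ℕ} (J : Matrix (Fin n) (Fin n) ℝ) (h : Fin n → ℝ)
    (σ : Config n) : ℝ :=
  weight J h σ / partitionFunction J h

open Classical in
/-- The probability of an event in the Ising model. -/
noncomputable def prob {n : ℕ} (J : Matrix (Fin n) (Fin n) ℝ) (h : Fin n → ℝ)
    (S : Set (Config n)) : ℝ :=
  ∑ σ : Config n, if σ ∈ S then mass J h σ else 0

/-- The expectation of a function of the configuration in the Ising model. -/
noncomputable def expect {n : ℕ} (J : Matrix (Fin n) (Fin n) ℝ) (h : Fin n → ℝ)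
    (f : Config n → ℝ) : ℝ :=
  ∑ σ : Config n, mass J h σ * f σ

/-- `max_i ∑ j, |J i j|`, which for symmetric `J` is the operator norm of `J` on `ℓ¹`. -/
noncomputable def norm11 {n : ℕ} (J : Matrix (Fin n) (Fin n) ℝ) : ℝ :=
  ⨆ i, ∑ j, |J i j|

/-- The quadratic form `σᵀ A σ`. -/
def quadForm {n : ℕ} (A : Matrix (Fin n) (Fin n) ℝ) (σ : Config n) : ℝ :=
  spin σ ⬝ᵥ (A *ᵥ spin σ)

/-- The Euclidean norm of `A σ`. -/
noncomputable def imageNorm {n : ℕ} (A : Matrix (Fin n) (Fin n) ℝ) (σ : Config n) : ℝ :=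
  ‖WithLp.toLp 2 (A *ᵥ spin σ)‖

/-- The operator norm of `A` for the Euclidean norm. -/
noncomputable def opNorm {n : ℕ} (A : Matrix (Fin n) (Fin n) ℝ) : ℝ :=
  ‖Matrix.toEuclideanCLM (𝕜 := ℝ) A‖

end Ising

namespace Ising

section Average

variable {Ω : Type*} [Fintype Ω]

/-- The average of `f` for the weights `m`. -/
def avg (m : Ω → ℝ) (f : Ω → ℝ) : ℝ := ∑ x, m x * f x

/-- `m` is a probability vector. -/
structure IsProb (m : Ω → ℝ) : Prop where
  nonneg : ∀ x, 0 ≤ m x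
  sum_eq_one : ∑ x, m x = 1

/-- The entropy functional of `f` for the weights `m`. -/
noncomputable def ent (m : Ω → ℝ) (f : Ω → ℝ) : ℝ :=
  avg m (fun x => f x * Real.log (f x)) - avg m f * Real.log (avg m f)

variable {m : Ω → ℝ}

lemma avg_add (f g : Ω → ℝ) : avg m (fun x => f x + g x) = avg m f + avg m g := by
  simp [avg, mul_add, Finset.sum_add_distrib]

lemma avg_sub (f g : Ω → ℝ) : avg m (fun x => f x - g x) = avg m f - avg m g := by
  simp [avg, mul_sub, Finset.sum_sub_distrib]

lemma avg_const_mul (c : ℝ) (f : Ω → ℝ) : avg m (fun x => c * f x) = c * avg m f := by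
  simp only [avg, Finset.mul_sum]
  exact Finset.sum_congr rfl fun _ _ => by ring

lemma avg_sum {κ : Type*} (s : Finset κ) (f : κ → Ω → ℝ) :
    avg m (fun x => ∑ k ∈ s, f k x) = ∑ k ∈ s, avg m (f k) := by
  simp only [avg, Finset.mul_sum]
  exact Finset.sum_comm

lemma IsProb.avg_const (hm : IsProb m) (c : ℝ) : avg m (fun _ => c) = c := by
  simp [avg, ← Finset.sum_mul, hm.sum_eq_one]

lemma avg_congr {f g : Ω → ℝ} (h : ∀ x, m x ≠ 0 → f x = g x) : avg m f = avg m g := by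
  refine Finset.sum_congr rfl fun x _ => ?_
  by_cases hx : m x = 0
  · simp [hx]
  · rw [h x hx]

lemma IsProb.avg_mono (hm : IsProb m) {f g : Ω → ℝ} (h : ∀ x, m x ≠ 0 → f x ≤ g x) :
    avg m f ≤ avg m g := by
  refine Finset.sum_le_sum fun x _ => ?_
  by_cases hx : m x = 0
  · simp [hx]
  · exact mul_le_mul_of_nonneg_left (h x hx) (hm.nonneg x)

lemma IsProb.avg_nonneg (hm : IsProb m) {f : Ω → ℝ} (h : ∀ x, 0 ≤ f x) : 0 ≤ avg m f :=
  Finset.sum_nonneg fun x _ => mul_nonneg (hm.nonneg x) (h x)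

lemma IsProb.avg_pos (hm : IsProb m) {f : Ω → ℝ} (h : ∀ x, 0 < f x) : 0 < avg m f := by
  have hne : ∃ x ∈ Finset.univ, m x ≠ 0 := by
    by_contra! h0
    have := hm.sum_eq_one
    rw [Finset.sum_eq_zero h0] at this
    norm_num at this
  obtain ⟨x, hx, hx0⟩ := hne
  exact Finset.sum_pos' (fun y _ => mul_nonneg (hm.nonneg y) (h y).le)
    ⟨x, hx, mul_pos (lt_of_le_of_ne (hm.nonneg x) (Ne.symm hx0)) (h x)⟩

lemma IsProb.abs_avg_le (hm : IsProb m) (f : Ω → ℝ) : |avg m f| ≤ avg m (fun x => |f x|) := by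
  refine (Finset.abs_sum_le_sum_abs _ _).trans (le_of_eq ?_)
  exact Finset.sum_congr rfl fun x _ => by rw [abs_mul, abs_of_nonneg (hm.nonneg x)]

/-- A Cauchy-Schwarz inequality. -/
lemma IsProb.sq_avg_le (hm : IsProb m) (r u : Ω → ℝ) (hu : ∀ x, 0 < u x) :
    avg m r ^ 2 ≤ avg m (fun x => r x ^ 2 / u x) * avg m u := by
  refine Finset.sum_sq_le_sum_mul_sum_of_sq_le_mul _ ?_ ?_ ?_
  · exact fun x _ => mul_nonneg (hm.nonneg x) (div_nonneg (sq_nonneg _) (hu x).le)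
  · exact fun x _ => mul_nonneg (hm.nonneg x) (hu x).le
  · intro x _
    have := (hu x).ne'
    refine le_of_eq ?_
    field_simp

/-- The entropy is at most the variance divided by the mean. -/
lemma IsProb.ent_le (hm : IsProb m) (u : Ω → ℝ) (hu : ∀ x, 0 < u x) :
    ent m u ≤ (avg m (fun x => u x ^ 2) - avg m u ^ 2) / avg m u := by
  have hM := hm.avg_pos hu
  set M := avg m u with hMdef
  have key : avg m (fun x => u x * Real.log (u x)) ≤
      avg m (fun x => (Real.log M - 1) * u x + M⁻¹ * u x ^ 2) := by
    refine hm.avg_mono fun x _ => ?_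
    have h1 := Real.log_le_sub_one_of_pos (div_pos (hu x) hM)
    rw [Real.log_div (hu x).ne' hM.ne'] at h1
    have h2 := mul_le_mul_of_nonneg_left h1 (hu x).le
    have h3 : u x * (u x / M - 1) = M⁻¹ * u x ^ 2 - u x := by
      field_simp
    nlinarith
  rw [avg_add, avg_const_mul, avg_const_mul, ← hMdef] at key
  rw [ent, ← hMdef]
  have : (avg m (fun x => u x ^ 2) - M ^ 2) / M = M⁻¹ * avg m (fun x => u x ^ 2) - M := by
    field_simp
  rw [this]
  linarith

/-- The variational inequality for the entropy. -/
lemma IsProb.avg_mul_le_ent (hm : IsProb m) (g y : Ω → ℝ) (hy : ∀ x, 0 < y x) :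
    avg m (fun x => g x * y x) ≤
      ent m y + avg m y * Real.log (avg m fun x => Real.exp (g x)) := by
  have hY := hm.avg_pos hy
  have hG := hm.avg_pos (f := fun x => Real.exp (g x)) fun x => Real.exp_pos _
  set Y := avg m y with hYdef
  set G := avg m (fun x => Real.exp (g x)) with hGdef
  have key : avg m (fun x => g x * y x) ≤ avg m (fun x => y x * Real.log (y x) +
      ((Real.log G - Real.log Y - 1) * y x + Y / G * Real.exp (g x))) := by
    refine hm.avg_mono fun x _ => ?_
    have hyx := hy x
    have h1 := Real.log_le_sub_one_of_pos
      (div_pos (mul_pos (Real.exp_pos (g x)) hY) (mul_pos hyx hG))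
    rw [Real.log_div (by positivity) (by positivity),
      Real.log_mul (Real.exp_pos _).ne' hY.ne', Real.log_mul hyx.ne' hG.ne', Real.log_exp] at h1
    have h2 := mul_le_mul_of_nonneg_left h1 hyx.le
    have h3 : y x * (Real.exp (g x) * Y / (y x * G) - 1) = Y / G * Real.exp (g x) - y x := by
      field_simp
    nlinarith
  rw [avg_add, avg_add, avg_const_mul, avg_const_mul, ← hYdef, ← hGdef,
    div_mul_cancel₀ _ hG.ne'] at key
  rw [ent, ← hYdef]
  linarith

end Average

section Kernel

variable {n : ℕ}

/-- The configuration `σ` with the spin at `i` reversed. -/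
def flip (i : Fin n) (σ : Config n) : Config n := Function.update σ i (-σ i)

/-- The configurations that agree with `σ` off `Λ`. -/
def fiber (Λ : Finset (Fin n)) (σ : Config n) : Finset (Config n) :=
  Finset.univ.filter fun τ => ∀ i, i ∉ Λ → τ i = σ i

/-- The conditional probabilities given the spins off `Λ`, for the weights `w`. -/
noncomputable def kernel (w : Config n → ℝ) (Λ : Finset (Fin n)) (σ τ : Config n) : ℝ :=
  if τ ∈ fiber Λ σ then w τ / ∑ υ ∈ fiber Λ σ, w υ else 0

/-- The conditional expectation given the spins off `Λ`, for the weights `w`. -/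
noncomputable def condExp (w : Config n → ℝ) (Λ : Finset (Fin n)) (f : Config n → ℝ)
    (σ : Config n) : ℝ :=
  avg (kernel w Λ σ) f

lemma mem_fiber {Λ : Finset (Fin n)} {σ τ : Config n} :
    τ ∈ fiber Λ σ ↔ ∀ i, i ∉ Λ → τ i = σ i := by simp [fiber]

lemma self_mem_fiber (Λ : Finset (Fin n)) (σ : Config n) : σ ∈ fiber Λ σ := by simp [fiber]

lemma fiber_comm {Λ : Finset (Fin n)} {σ τ : Config n} : τ ∈ fiber Λ σ ↔ σ ∈ fiber Λ τ := by
  simp only [mem_fiber]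
  exact ⟨fun h i hi => (h i hi).symm, fun h i hi => (h i hi).symm⟩

lemma fiber_eq {Λ : Finset (Fin n)} {σ τ : Config n} (h : τ ∈ fiber Λ σ) :
    fiber Λ τ = fiber Λ σ := by
  ext υ
  simp only [mem_fiber] at h ⊢
  exact ⟨fun h' i hi => (h' i hi).trans (h i hi), fun h' i hi => (h' i hi).trans (h i hi).symm⟩

lemma fiber_mono {Λ Δ : Finset (Fin n)} (hΔ : Δ ⊆ Λ) (σ : Config n) :
    fiber Δ σ ⊆ fiber Λ σ := by
  intro τ h
  rw [mem_fiber] at h ⊢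
  exact fun i hi => h i fun hi' => hi (hΔ hi')

lemma units_eq_or_eq_neg (u v : ℤˣ) : u = v ∨ u = -v := by
  rcases Int.units_eq_one_or u with rfl | rfl <;> rcases Int.units_eq_one_or v with rfl | rfl <;>
    simp

lemma flip_apply_self (i : Fin n) (σ : Config n) : flip i σ i = -σ i := by simp [flip]

lemma flip_apply_of_ne {i j : Fin n} (h : j ≠ i) (σ : Config n) : flip i σ j = σ j := by
  simp [flip, h]

lemma flip_flip (i : Fin n) (σ : Config n) : flip i (flip i σ) = σ := by simp [flip]

lemma flip_ne (i : Fin n) (σ : Config n) : flip i σ ≠ σ := by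
  intro h
  have h1 := congrFun h i
  rw [flip_apply_self] at h1
  exact units_ne_neg_self (σ i) h1.symm

lemma flip_comm (i j : Fin n) (σ : Config n) : flip i (flip j σ) = flip j (flip i σ) := by
  by_cases h : i = j
  · rw [h]
  · have h' : j ≠ i := fun e => h e.symm
    ext k
    by_cases hi : k = i
    · subst hi; simp [flip, h]
    · by_cases hj : k = j
      · subst hj; simp [flip, h']
      · simp [flip, hi, hj]

lemma flip_mem_fiber {Λ : Finset (Fin n)} {i : Fin n} (hi : i ∈ Λ) (σ : Config n) :
    flip i σ ∈ fiber Λ σ := by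
  rw [mem_fiber]
  intro j hj
  exact flip_apply_of_ne (by rintro rfl; exact hj hi) σ

lemma fiber_singleton (i : Fin n) (σ : Config n) : fiber {i} σ = {σ, flip i σ} := by
  ext τ
  simp only [mem_fiber, Finset.mem_singleton, Finset.mem_insert]
  constructor
  · intro h
    rcases units_eq_or_eq_neg (τ i) (σ i) with h1 | h1
    · left
      ext j
      by_cases hj : j = i
      · rw [hj, h1]
      · rw [h j hj]
    · right
      ext j
      by_cases hj : j = i
      · rw [hj, h1, flip_apply_self]
      · rw [h j hj, flip_apply_of_ne hj]
  · rintro (rfl | rfl) j hj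
    · rfl
    · exact flip_apply_of_ne hj σ

variable {w : Config n → ℝ}

lemma sum_fiber_pos (hw : ∀ σ, 0 < w σ) (Λ : Finset (Fin n)) (σ : Config n) :
    0 < ∑ υ ∈ fiber Λ σ, w υ :=
  Finset.sum_pos (fun υ _ => hw υ) ⟨σ, self_mem_fiber Λ σ⟩

lemma kernel_isProb (hw : ∀ σ, 0 < w σ) (Λ : Finset (Fin n)) (σ : Config n) :
    IsProb (kernel w Λ σ) where
  nonneg τ := by
    unfold kernel
    split_ifs
    · exact div_nonneg (hw τ).le (sum_fiber_pos hw Λ σ).le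
    · exact le_rfl
  sum_eq_one := by
    simp only [kernel]
    rw [Finset.sum_ite_mem, Finset.univ_inter, ← Finset.sum_div,
      div_self (sum_fiber_pos hw Λ σ).ne']

lemma mem_fiber_of_kernel_ne_zero {Λ : Finset (Fin n)} {σ τ : Config n}
    (h : kernel w Λ σ τ ≠ 0) : τ ∈ fiber Λ σ := by
  by_contra h'
  exact h (if_neg h')

lemma kernel_eq {Λ : Finset (Fin n)} {σ τ : Config n} (h : τ ∈ fiber Λ σ) :
    kernel w Λ τ = kernel w Λ σ := by
  ext υ
  rw [kernel, kernel, fiber_eq h]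

lemma condExp_eq {Λ : Finset (Fin n)} {σ τ : Config n} (h : τ ∈ fiber Λ σ) (f : Config n → ℝ) :
    condExp w Λ f τ = condExp w Λ f σ := by
  rw [condExp, condExp, kernel_eq h]

lemma condExp_congr {Λ : Finset (Fin n)} {σ : Config n} {f g : Config n → ℝ}
    (h : ∀ τ ∈ fiber Λ σ, f τ = g τ) : condExp w Λ f σ = condExp w Λ g σ :=
  avg_congr fun τ hτ => h τ (mem_fiber_of_kernel_ne_zero hτ)

/-- The tower property. -/
lemma condExp_condExp (hw : ∀ σ, 0 < w σ) {Δ Λ : Finset (Fin n)} (hΔ : Δ ⊆ Λ)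
    (f : Config n → ℝ) (σ : Config n) :
    condExp w Λ (condExp w Δ f) σ = condExp w Λ f σ := by
  simp only [condExp, avg, Finset.mul_sum]
  rw [Finset.sum_comm]
  refine Finset.sum_congr rfl fun υ _ => ?_
  have h1 : ∀ τ, kernel w Λ σ τ * (kernel w Δ τ υ * f υ) =
      kernel w Δ υ τ * (kernel w Λ σ υ * f υ) := by
    intro τ
    simp only [kernel]
    by_cases h : υ ∈ fiber Δ τ
    · have h' := fiber_comm.1 h
      rw [if_pos h, if_pos h', fiber_eq h]
      have h2 := fiber_eq (fiber_mono hΔ _ h)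
      have h3 : τ ∈ fiber Λ σ ↔ υ ∈ fiber Λ σ := by
        rw [fiber_comm, ← h2, ← fiber_comm]
      simp only [h3]
      split_ifs
      · ring
      · simp
    · rw [if_neg h, if_neg fun h' => h (fiber_comm.1 h')]
      simp
  rw [Finset.sum_congr rfl fun τ _ => h1 τ, ← Finset.sum_mul,
    (kernel_isProb hw Δ υ).sum_eq_one, one_mul]

/-- A factor that is constant on the fiber can be taken out. -/
lemma condExp_mul {Λ : Finset (Fin n)} {σ : Config n} {c : ℝ} {f g : Config n → ℝ}
    (h : ∀ τ ∈ fiber Λ σ, g τ = c) :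
    condExp w Λ (fun τ => g τ * f τ) σ = c * condExp w Λ f σ := by
  rw [condExp_congr (g := fun τ => c * f τ) fun τ hτ => by rw [h τ hτ]]
  exact avg_const_mul c f

/-- The conditional probability of reversing the spin at `i`. -/
noncomputable def flipProb (w : Config n → ℝ) (i : Fin n) (σ : Config n) : ℝ :=
  w (flip i σ) / (w σ + w (flip i σ))

lemma condExp_singleton (hw : ∀ σ, 0 < w σ) (i : Fin n) (f : Config n → ℝ) (σ : Config n) :
    condExp w {i} f σ = f σ + flipProb w i σ * (f (flip i σ) - f σ) := by
  have h0 := hw σ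
  have h1 := hw (flip i σ)
  have hne : σ ≠ flip i σ := (flip_ne i σ).symm
  simp only [condExp, avg, kernel, ite_mul, zero_mul]
  rw [Finset.sum_ite_mem, Finset.univ_inter, fiber_singleton, Finset.sum_pair hne,
    Finset.sum_pair hne, flipProb]
  field_simp
  ring

lemma flipProb_pos (hw : ∀ σ, 0 < w σ) (i : Fin n) (σ : Config n) : 0 < flipProb w i σ :=
  div_pos (hw _) (add_pos (hw _) (hw _))

lemma flipProb_flip (hw : ∀ σ, 0 < w σ) (i : Fin n) (σ : Config n) :
    flipProb w i (flip i σ) = 1 - flipProb w i σ := by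
  have h0 := hw σ
  have h1 := hw (flip i σ)
  rw [flipProb, flipProb, flip_flip]
  field_simp
  ring

lemma flipProb_lt_one (hw : ∀ σ, 0 < w σ) (i : Fin n) (σ : Config n) : flipProb w i σ < 1 := by
  have := flipProb_pos hw i (flip i σ)
  rw [flipProb_flip hw] at this
  linarith

end Kernel


section Comparison

variable {n : ℕ} {w : Config n → ℝ}

/-- The conditional standard deviation of `f` under resampling of the spin at `i`, up to a factor
`√(p (1 - p))`. -/
noncomputable def resid (w : Config n → ℝ) (f : Config n → ℝ) (i : Fin n) (σ : Config n) : ℝ :=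
  flipProb w i σ * (1 - flipProb w i σ) * |f σ - f (flip i σ)|

lemma condExp_mul_sub (hw : ∀ σ, 0 < w σ) (i : Fin n) (f g : Config n → ℝ) (σ : Config n) :
    condExp w {i} (fun τ => f τ * (g τ - condExp w {i} g τ)) σ =
      flipProb w i σ * (1 - flipProb w i σ) * ((f σ - f (flip i σ)) * (g σ - g (flip i σ))) := by
  rw [condExp_singleton hw, condExp_singleton hw, condExp_singleton hw, flip_flip,
    flipProb_flip hw]
  ring

lemma abs_condExp_mul_sub_le (hw : ∀ σ, 0 < w σ) (i : Fin n) (f g : Config n → ℝ) (σ : Config n)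
    {d : ℝ} (hd : |g σ - g (flip i σ)| ≤ d) :
    |condExp w {i} (fun τ => f τ * (g τ - condExp w {i} g τ)) σ| ≤ d * resid w f i σ := by
  have h0 := flipProb_pos hw i σ
  have h1 := flipProb_lt_one hw i σ
  have h2 : 0 ≤ flipProb w i σ * (1 - flipProb w i σ) :=
    mul_nonneg h0.le (by linarith)
  rw [condExp_mul_sub hw, abs_mul, abs_of_nonneg h2, abs_mul, resid]
  nlinarith [mul_le_mul_of_nonneg_left hd (mul_nonneg h2 (abs_nonneg (f σ - f (flip i σ))))]

/-- `C i j` bounds the influence of the spin at `j` on the conditional law of the spin at `i`. -/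
def Influence (w : Config n → ℝ) (C : Matrix (Fin n) (Fin n) ℝ) : Prop :=
  ∀ i j, i ≠ j → ∀ σ, |flipProb w i σ - flipProb w i (flip j σ)| ≤ C i j

lemma condExp_singleton_flip (i : Fin n) (g : Config n → ℝ)
    (σ : Config n) : condExp w {i} g (flip i σ) = condExp w {i} g σ :=
  condExp_eq (flip_mem_fiber (Finset.mem_singleton_self i) σ) g

lemma abs_condExp_singleton_sub_le (hw : ∀ σ, 0 < w σ) {C : Matrix (Fin n) (Fin n) ℝ}
    (hC : Influence w C) {i j : Fin n} (hij : i ≠ j) {g : Config n → ℝ} {di dj : ℝ}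
    (hdi : ∀ σ, |g σ - g (flip i σ)| ≤ di) (hdj : ∀ σ, |g σ - g (flip j σ)| ≤ dj)
    (σ : Config n) :
    |condExp w {i} g σ - condExp w {i} g (flip j σ)| ≤ dj + C i j * di := by
  rw [condExp_singleton hw, condExp_singleton hw]
  have hp0 := flipProb_pos hw i σ
  have hp1 := flipProb_lt_one hw i σ
  have hc := hC i j hij σ
  set p := flipProb w i σ
  set p' := flipProb w i (flip j σ)
  have e : g σ + p * (g (flip i σ) - g σ) -
      (g (flip j σ) + p' * (g (flip i (flip j σ)) - g (flip j σ))) =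
      (1 - p) * (g σ - g (flip j σ)) + p * (g (flip i σ) - g (flip j (flip i σ))) +
        (p' - p) * (g (flip j σ) - g (flip i (flip j σ))) := by
    rw [flip_comm i j]
    ring
  rw [e]
  have h1 : |(1 - p) * (g σ - g (flip j σ))| ≤ (1 - p) * dj := by
    rw [abs_mul, abs_of_pos (by linarith : 0 < 1 - p)]
    exact mul_le_mul_of_nonneg_left (hdj σ) (by linarith)
  have h2 : |p * (g (flip i σ) - g (flip j (flip i σ)))| ≤ p * dj := by
    rw [abs_mul, abs_of_pos hp0]
    exact mul_le_mul_of_nonneg_left (hdj _) hp0.le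
  have h3 : |(p' - p) * (g (flip j σ) - g (flip i (flip j σ)))| ≤ C i j * di := by
    rw [abs_mul, abs_sub_comm]
    exact mul_le_mul hc (hdi _) (abs_nonneg _) ((abs_nonneg _).trans hc)
  exact (abs_add_three _ _ _).trans (by linarith)

/-- The vector `a` bounds the discrepancy between the conditional law and the law with density `f`
in terms of the coordinatewise oscillations of the test function. -/
def IsEstimate (w : Config n → ℝ) (Λ : Finset (Fin n)) (f : Config n → ℝ) (σ : Config n)
    (a : Fin n → ℝ) : Prop :=
  ∀ (g : Config n → ℝ) (d : Fin n → ℝ),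
    (∀ i ∈ Λ, ∀ τ, |g τ - g (flip i τ)| ≤ d i) →
      |condExp w Λ (fun τ => f τ * g τ) σ - condExp w Λ f σ * condExp w Λ g σ| ≤
        condExp w Λ f σ * ∑ i ∈ Λ, a i * d i

lemma abs_sub_le_of_mem_fiber {g : Config n → ℝ} {d : Fin n → ℝ} (Λ : Finset (Fin n))
    (h : ∀ i ∈ Λ, ∀ τ, |g τ - g (flip i τ)| ≤ d i) {σ τ : Config n} (hτ : τ ∈ fiber Λ σ) :
    |g τ - g σ| ≤ ∑ i ∈ Λ, d i := by
  induction Λ using Finset.induction_on generalizing τ with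
  | empty =>
    have : τ = σ := funext fun i => mem_fiber.1 hτ i (by simp)
    simp [this]
  | insert i Λ hi ih =>
    rw [Finset.sum_insert hi]
    have hd := h i (Finset.mem_insert_self i Λ) τ
    have ih' := fun {τ} => @ih (fun j hj => h j (Finset.mem_insert_of_mem hj)) τ
    rw [mem_fiber] at hτ
    rcases units_eq_or_eq_neg (τ i) (σ i) with hs | hs
    · have : τ ∈ fiber Λ σ := by
        rw [mem_fiber]
        intro j hj
        by_cases hji : j = i
        · rw [hji, hs]
        · exact hτ j (by simp [hji, hj])
      have := ih' this
      linarith [abs_nonneg (g τ - g (flip i τ))]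
    · have : flip i τ ∈ fiber Λ σ := by
        rw [mem_fiber]
        intro j hj
        by_cases hji : j = i
        · rw [hji, flip_apply_self, hs, neg_neg]
        · rw [flip_apply_of_ne hji]
          exact hτ j (by simp [hji, hj])
      have := ih' this
      have h3 := abs_sub_le (g τ) (g (flip i τ)) (g σ)
      linarith

lemma isEstimate_one (hw : ∀ σ, 0 < w σ) (Λ : Finset (Fin n)) {f : Config n → ℝ}
    (hf : ∀ σ, 0 < f σ) (σ : Config n) : IsEstimate w Λ f σ 1 := by
  intro g d hd
  have hm := kernel_isProb hw Λ σ
  set D := ∑ i ∈ Λ, d i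
  set c := condExp w Λ g σ
  have hosc : ∀ τ ∈ fiber Λ σ, |g τ - c| ≤ D := by
    intro τ hτ
    have e : g τ - c = avg (kernel w Λ σ) (fun υ => g τ - g υ) := by
      rw [avg_sub, hm.avg_const]; rfl
    rw [e]
    refine (hm.abs_avg_le _).trans ?_
    rw [← hm.avg_const D]
    refine hm.avg_mono fun υ hυ => ?_
    have hυ' := mem_fiber_of_kernel_ne_zero hυ
    rw [← fiber_eq hυ'] at hτ
    exact abs_sub_le_of_mem_fiber Λ hd hτ
  have e : condExp w Λ (fun τ => f τ * g τ) σ - condExp w Λ f σ * c =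
      avg (kernel w Λ σ) (fun τ => f τ * (g τ - c)) := by
    simp only [mul_sub, avg_sub]
    rw [show (fun τ => f τ * c) = fun τ => c * f τ from funext fun _ => mul_comm _ _,
      avg_const_mul, mul_comm c]
    rfl
  rw [e]
  refine (hm.abs_avg_le _).trans ?_
  have : condExp w Λ f σ * ∑ i ∈ Λ, (1 : Fin n → ℝ) i * d i =
      avg (kernel w Λ σ) (fun τ => D * f τ) := by
    rw [avg_const_mul, mul_comm]
    simp [condExp, D]
  rw [this]
  refine hm.avg_mono fun τ hτ => ?_
  rw [abs_mul, abs_of_pos (hf τ), mul_comm]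
  exact mul_le_mul_of_nonneg_right (hosc τ (mem_fiber_of_kernel_ne_zero hτ)) (hf τ).le

/-- Resampling one spin improves an estimate. -/
lemma IsEstimate.update (hw : ∀ σ, 0 < w σ) {C : Matrix (Fin n) (Fin n) ℝ}
    (hC : Influence w C) (hC0 : ∀ i j, 0 ≤ C i j) {Λ : Finset (Fin n)} {f : Config n → ℝ}
    (hf : ∀ σ, 0 < f σ) {σ : Config n} {a : Fin n → ℝ} (ha0 : ∀ i, 0 ≤ a i)
    (ha : IsEstimate w Λ f σ a) {i : Fin n} (hi : i ∈ Λ) :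
    IsEstimate w Λ f σ (Function.update a i
      (condExp w Λ (resid w f i) σ / condExp w Λ f σ + ∑ j ∈ Λ, C i j * a j)) := by
  intro g d hd
  have hm := kernel_isProb hw Λ σ
  have hM : 0 < condExp w Λ f σ := hm.avg_pos hf
  have hsub : {i} ⊆ Λ := Finset.singleton_subset_iff.2 hi
  have hdi0 : 0 ≤ d i := (abs_nonneg _).trans (hd i hi σ)
  set G := condExp w {i} g with hG
  have h1 : |condExp w Λ (fun τ => f τ * (g τ - G τ)) σ| ≤
      d i * condExp w Λ (resid w f i) σ := by
    rw [← condExp_condExp hw hsub (fun τ => f τ * (g τ - G τ))]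
    refine (hm.abs_avg_le _).trans ?_
    rw [condExp, ← avg_const_mul]
    exact hm.avg_mono fun τ _ => abs_condExp_mul_sub_le hw i f g τ (hd i hi τ)
  have h2 := ha G (fun j => if j = i then 0 else d j + C i j * d i) (by
    intro j hj τ
    by_cases hji : j = i
    · subst hji
      rw [if_pos rfl, hG, condExp_singleton_flip, sub_self, abs_zero]
    · rw [if_neg hji]
      exact abs_condExp_singleton_sub_le hw hC (fun h => hji h.symm) (hd i hi) (hd j hj) τ)
  rw [hG, condExp_condExp hw hsub g, ← hG] at h2
  have e : condExp w Λ (fun τ => f τ * g τ) σ - condExp w Λ f σ * condExp w Λ g σ =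
      condExp w Λ (fun τ => f τ * (g τ - G τ)) σ +
        (condExp w Λ (fun τ => f τ * G τ) σ - condExp w Λ f σ * condExp w Λ g σ) := by
    simp only [condExp, mul_sub, avg_sub]
    ring
  rw [e]
  refine (abs_add_le _ _).trans ((add_le_add h1 h2).trans ?_)
  rw [← Finset.add_sum_erase Λ _ hi, ← Finset.add_sum_erase Λ
    (fun j => Function.update a i _ j * d j) hi]
  have h3 : ∑ j ∈ Λ.erase i, a j * (if j = i then 0 else d j + C i j * d i) ≤
      ∑ j ∈ Λ.erase i, a j * d j + d i * ∑ j ∈ Λ, C i j * a j := by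
    have : ∑ j ∈ Λ.erase i, C i j * a j ≤ ∑ j ∈ Λ, C i j * a j :=
      Finset.sum_le_sum_of_subset_of_nonneg (Finset.erase_subset _ _)
        fun j _ _ => mul_nonneg (hC0 i j) (ha0 j)
    refine le_trans (le_of_eq ?_) (add_le_add_right (mul_le_mul_of_nonneg_left this hdi0) _)
    rw [Finset.mul_sum, ← Finset.sum_add_distrib]
    refine Finset.sum_congr rfl fun j hj => ?_
    rw [if_neg (Finset.ne_of_mem_erase hj)]
    ring
  have h4 : ∑ j ∈ Λ.erase i, Function.update a i
      (condExp w Λ (resid w f i) σ / condExp w Λ f σ + ∑ j ∈ Λ, C i j * a j) j * d j =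
      ∑ j ∈ Λ.erase i, a j * d j :=
    Finset.sum_congr rfl fun j hj => by
      rw [Function.update_of_ne (Finset.ne_of_mem_erase hj)]
  rw [h4, Function.update_self, if_pos rfl, mul_zero, zero_add]
  have h5 := mul_le_mul_of_nonneg_left h3 hM.le
  have h6 : condExp w Λ f σ * ((condExp w Λ (resid w f i) σ / condExp w Λ f σ +
      ∑ j ∈ Λ, C i j * a j) * d i + ∑ j ∈ Λ.erase i, a j * d j) =
      d i * condExp w Λ (resid w f i) σ +
      condExp w Λ f σ * (∑ j ∈ Λ.erase i, a j * d j + d i * ∑ j ∈ Λ, C i j * a j) := by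
    field_simp
    ring
  rw [h6]
  linarith

lemma exists_isEstimate_le (hw : ∀ σ, 0 < w σ) {C : Matrix (Fin n) (Fin n) ℝ}
    (hC : Influence w C) (hC0 : ∀ i j, 0 ≤ C i j) (Λ : Finset (Fin n)) {f : Config n → ℝ}
    (hf : ∀ σ, 0 < f σ) (σ : Config n) :
    ∃ a : Fin n → ℝ, (∀ i, 0 ≤ a i) ∧ IsEstimate w Λ f σ a ∧
      ∀ i ∈ Λ, a i ≤ condExp w Λ (resid w f i) σ / condExp w Λ f σ + ∑ j ∈ Λ, C i j * a j := by
  have hm := kernel_isProb hw Λ σ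
  have hM : 0 < condExp w Λ f σ := hm.avg_pos hf
  have hclosed : IsClosed {a | IsEstimate w Λ f σ a} := by
    simp only [IsEstimate, Set.ofPred_forall]
    refine isClosed_iInter fun g => isClosed_iInter fun d => isClosed_iInter fun _ => ?_
    exact isClosed_le continuous_const (by fun_prop)
  have hcomp : IsCompact (Set.Icc (0 : Fin n → ℝ) 1 ∩ {a | IsEstimate w Λ f σ a}) :=
    isCompact_Icc.inter_right hclosed
  obtain ⟨a, ⟨⟨ha0, ha1⟩, ha⟩, hmin⟩ := hcomp.exists_isMinOn
    (f := fun a : Fin n → ℝ => ∑ i, a i)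
    ⟨1, ⟨⟨zero_le_one, le_rfl⟩, isEstimate_one hw Λ hf σ⟩⟩ (by fun_prop)
  refine ⟨a, ha0, ha, fun i hi => ?_⟩
  by_contra! hlt
  have hest := ha.update hw hC hC0 hf ha0 hi
  set b := condExp w Λ (resid w f i) σ / condExp w Λ f σ + ∑ j ∈ Λ, C i j * a j with hb
  have hb0 : 0 ≤ b := by
    refine add_nonneg (div_nonneg (hm.avg_nonneg fun τ => ?_) hM.le)
      (Finset.sum_nonneg fun j _ => mul_nonneg (hC0 i j) (ha0 j))
    exact mul_nonneg (mul_nonneg (flipProb_pos hw i τ).le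
      (sub_nonneg.2 (flipProb_lt_one hw i τ).le)) (abs_nonneg _)
  have hmem : Function.update a i b ∈
      Set.Icc (0 : Fin n → ℝ) 1 ∩ {a | IsEstimate w Λ f σ a} := by
    refine ⟨⟨fun j => ?_, fun j => ?_⟩, hest⟩
    · by_cases hj : j = i
      · subst hj; simpa using hb0
      · simpa [hj] using ha0 j
    · by_cases hj : j = i
      · subst hj; simpa using hlt.le.trans (ha1 j)
      · simpa [hj] using ha1 j
  have h1 : ∑ j, a j ≤ ∑ j, Function.update a i b j := hmin hmem
  have h2 : ∑ j, Function.update a i b j < ∑ j, a j := by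
    refine Finset.sum_lt_sum (fun j _ => ?_) ⟨i, Finset.mem_univ i, by simpa using hlt⟩
    by_cases hj : j = i
    · subst hj; simpa using hlt.le
    · simp [hj]
  linarith

/-- A quadratic bound for subsolutions of `a = b + C a` when `C` has row sums at most `1 - ρ`. -/
lemma sum_sq_le_of_le_add {ι : Type*} (Λ : Finset ι) {C : ι → ι → ℝ} {a b : ι → ℝ} {ρ : ℝ}
    (hρ : 0 < ρ) (hC0 : ∀ i j, 0 ≤ C i j) (hsymm : ∀ i j, C i j = C j i)
    (hrow : ∀ i, ∑ j ∈ Λ, C i j ≤ 1 - ρ) (ha0 : ∀ i, 0 ≤ a i)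
    (h : ∀ i ∈ Λ, a i ≤ b i + ∑ j ∈ Λ, C i j * a j) :
    ∑ i ∈ Λ, a i ^ 2 ≤ (∑ i ∈ Λ, b i ^ 2) / ρ ^ 2 := by
  have h1 : ∑ i ∈ Λ, a i ^ 2 ≤ ∑ i ∈ Λ, a i * b i + ∑ i ∈ Λ, ∑ j ∈ Λ, C i j * (a i * a j) := by
    rw [← Finset.sum_add_distrib]
    refine Finset.sum_le_sum fun i hi => ?_
    have := mul_le_mul_of_nonneg_left (h i hi) (ha0 i)
    rw [mul_add, Finset.mul_sum] at this
    calc a i ^ 2 = a i * a i := sq _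
      _ ≤ _ := this
      _ = _ := by
        congr 1
        exact Finset.sum_congr rfl fun j _ => by ring
  have h2 : ∑ i ∈ Λ, ∑ j ∈ Λ, C i j * a i ^ 2 ≤ (1 - ρ) * ∑ i ∈ Λ, a i ^ 2 := by
    rw [Finset.mul_sum]
    refine Finset.sum_le_sum fun i _ => ?_
    rw [← Finset.sum_mul]
    exact mul_le_mul_of_nonneg_right (hrow i) (sq_nonneg _)
  have h3 : ∑ i ∈ Λ, ∑ j ∈ Λ, C i j * a j ^ 2 ≤ (1 - ρ) * ∑ i ∈ Λ, a i ^ 2 := by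
    rw [Finset.sum_comm]
    refine le_trans (le_of_eq ?_) h2
    exact Finset.sum_congr rfl fun i _ => Finset.sum_congr rfl fun j _ => by rw [hsymm]
  have h4 : 2 * ∑ i ∈ Λ, ∑ j ∈ Λ, C i j * (a i * a j) ≤
      ∑ i ∈ Λ, ∑ j ∈ Λ, C i j * a i ^ 2 + ∑ i ∈ Λ, ∑ j ∈ Λ, C i j * a j ^ 2 := by
    simp only [Finset.mul_sum, ← Finset.sum_add_distrib]
    refine Finset.sum_le_sum fun i _ => Finset.sum_le_sum fun j _ => ?_
    nlinarith [mul_nonneg (hC0 i j) (sq_nonneg (a i - a j))]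
  have h5 : 2 * ρ * ∑ i ∈ Λ, a i * b i ≤ ρ ^ 2 * ∑ i ∈ Λ, a i ^ 2 + ∑ i ∈ Λ, b i ^ 2 := by
    simp only [Finset.mul_sum, ← Finset.sum_add_distrib]
    exact Finset.sum_le_sum fun i _ => by nlinarith [sq_nonneg (ρ * a i - b i)]
  rw [le_div_iff₀ (by positivity)]
  nlinarith

end Comparison


section Entropy

variable {n : ℕ} {w : Config n → ℝ}

lemma spin_sq (i : Fin n) (σ : Config n) : spin σ i ^ 2 = 1 := by
  rcases Int.units_eq_one_or (σ i) with h | h <;> simp [spin, h]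

lemma spin_flip_self (i : Fin n) (σ : Config n) : spin (flip i σ) i = -spin σ i := by
  simp [spin, flip_apply_self]

lemma spin_flip_of_ne {i j : Fin n} (h : j ≠ i) (σ : Config n) :
    spin (flip i σ) j = spin σ j := by
  simp [spin, flip_apply_of_ne h]

lemma abs_spin (i : Fin n) (σ : Config n) : |spin σ i| = 1 := by
  rw [← sq_eq_sq₀ (abs_nonneg _) zero_le_one, sq_abs, spin_sq, one_pow]

/-- A lower bound for the conditional variance of a spin. -/
lemma le_one_sub_condExp_spin_sq (hw : ∀ σ, 0 < w σ) {β : ℝ}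
    (hβ : ∀ i σ, β ≤ flipProb w i σ * (1 - flipProb w i σ)) {Λ : Finset (Fin n)} {i : Fin n}
    (hi : i ∈ Λ) (σ : Config n) :
    4 * β ≤ 1 - condExp w Λ (fun τ => spin τ i) σ ^ 2 := by
  have hm := kernel_isProb hw Λ σ
  set c := condExp w Λ (fun τ => spin τ i) σ with hc
  have h1 : condExp w Λ (fun τ => 1 - c * (2 * spin τ i) + c ^ 2) σ = 1 - c ^ 2 := by
    simp only [condExp, avg_add, avg_sub, avg_const_mul, hm.avg_const]
    rw [show avg (kernel w Λ σ) (fun τ => spin τ i) = c from rfl]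
    ring
  rw [← h1, ← condExp_condExp hw (Finset.singleton_subset_iff.2 hi), ← hm.avg_const (4 * β)]
  refine hm.avg_mono fun τ _ => ?_
  rw [condExp_singleton hw, spin_flip_self]
  nlinarith [hβ i τ, spin_sq i τ, sq_nonneg (c - spin τ i * (1 - 2 * flipProb w i τ)),
    sq_nonneg (1 - 2 * flipProb w i τ)]

/-- The chain rule for the entropy. -/
lemma ent_eq_condExp_add (hw : ∀ σ, 0 < w σ) {Δ Λ : Finset (Fin n)} (hΔ : Δ ⊆ Λ)
    (f : Config n → ℝ) (σ : Config n) :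
    ent (kernel w Λ σ) f = condExp w Λ (fun τ => ent (kernel w Δ τ) f) σ +
      ent (kernel w Λ σ) (condExp w Δ f) := by
  have h1 := condExp_condExp hw hΔ (fun x => f x * Real.log (f x)) σ
  have h2 := condExp_condExp hw hΔ f σ
  unfold ent
  simp only [condExp, avg_sub] at h1 h2 ⊢
  have h3 : avg (kernel w Λ σ) (fun τ => avg (kernel w Δ τ) fun x => f x * Real.log (f x)) =
      avg (kernel w Λ σ) fun x => f x * Real.log (f x) := h1
  rw [h2, h3]
  ring

/-- The entropy of the marginal law of one spin is controlled by an estimate. -/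
lemma ent_condExp_erase_le (hw : ∀ σ, 0 < w σ) {β : ℝ} (hβ0 : 0 < β)
    (hβ : ∀ i σ, β ≤ flipProb w i σ * (1 - flipProb w i σ)) {Λ : Finset (Fin n)}
    {f : Config n → ℝ} (hf : ∀ σ, 0 < f σ) {σ : Config n} {a : Fin n → ℝ}
    (ha : IsEstimate w Λ f σ a) {i : Fin n} (hi : i ∈ Λ) :
    ent (kernel w Λ σ) (condExp w (Λ.erase i) f) ≤ condExp w Λ f σ * a i ^ 2 / β := by
  have hm := kernel_isProb hw Λ σ
  have hM : 0 < condExp w Λ f σ := hm.avg_pos hf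
  have hsub := Finset.erase_subset i Λ
  set u := condExp w (Λ.erase i) f with hu
  set M := condExp w Λ f σ with hMdef
  set s : Config n → ℝ := fun τ => spin τ i with hs
  have hu0 : ∀ τ, 0 < u τ := fun τ => (kernel_isProb hw _ τ).avg_pos hf
  have huM : avg (kernel w Λ σ) u = M := condExp_condExp hw hsub f σ
  obtain ⟨c, d, hcd⟩ : ∃ c d, ∀ τ ∈ fiber Λ σ, u τ = c + d * s τ := by
    refine ⟨(u σ + u (flip i σ)) / 2, (u σ - u (flip i σ)) / 2 * s σ, fun τ hτ => ?_⟩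
    have hsq : s σ * s σ = 1 := by rw [← sq]; exact spin_sq i σ
    rcases units_eq_or_eq_neg (τ i) (σ i) with h | h
    · have hmem : τ ∈ fiber (Λ.erase i) σ := by
        rw [mem_fiber] at hτ ⊢
        intro j hj
        by_cases hji : j = i
        · rw [hji, h]
        · exact hτ j fun hj' => hj (Finset.mem_erase.2 ⟨hji, hj'⟩)
      have hsτ : s τ = s σ := by simp [hs, spin, h]
      rw [hu, condExp_eq hmem, hsτ, mul_assoc, hsq]
      ring
    · have hmem : τ ∈ fiber (Λ.erase i) (flip i σ) := by
        rw [mem_fiber] at hτ ⊢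
        intro j hj
        by_cases hji : j = i
        · rw [hji, h, flip_apply_self]
        · rw [flip_apply_of_ne hji]
          exact hτ j fun hj' => hj (Finset.mem_erase.2 ⟨hji, hj'⟩)
      have hsτ : s τ = -s σ := by simp [hs, spin, h]
      rw [hu, condExp_eq hmem, hsτ, mul_neg, mul_assoc, hsq]
      ring
  set e := condExp w Λ s σ with he
  set V := 1 - e ^ 2 with hV
  have hVβ : 4 * β ≤ V := le_one_sub_condExp_spin_sq hw hβ hi σ
  have hV0 : 0 < V := by linarith
  have hMe : M = c + d * e := by
    rw [← huM, show avg (kernel w Λ σ) u = condExp w Λ u σ from rfl, condExp_congr hcd]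
    simp only [condExp, avg_add, avg_const_mul, hm.avg_const]
    rfl
  have hu2 : avg (kernel w Λ σ) (fun τ => u τ ^ 2) = (c ^ 2 + d ^ 2) + 2 * c * d * e := by
    have : condExp w Λ (fun τ => u τ ^ 2) σ =
        condExp w Λ (fun τ => (c ^ 2 + d ^ 2) + (2 * c * d) * s τ) σ := by
      refine condExp_congr fun τ hτ => ?_
      rw [hcd τ hτ]
      linear_combination d ^ 2 * spin_sq i τ
    simp only [condExp, avg_add, avg_const_mul, hm.avg_const] at this
    exact this
  have hus : condExp w Λ (fun τ => f τ * s τ) σ = c * e + d := by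
    rw [← condExp_condExp hw hsub]
    have : condExp w Λ (condExp w (Λ.erase i) fun τ => f τ * s τ) σ =
        condExp w Λ (fun τ => c * s τ + d) σ := by
      refine condExp_congr fun τ hτ => ?_
      have h1 : (fun υ => f υ * s υ) = fun υ => s υ * f υ := funext fun _ => mul_comm _ _
      rw [h1, condExp_mul (c := s τ), ← hu, hcd τ hτ]
      · linear_combination d * spin_sq i τ
      · intro υ hυ
        rw [mem_fiber] at hυ
        simp [hs, spin, hυ i (Finset.notMem_erase i Λ)]
    rw [this]
    simp only [condExp, avg_add, avg_const_mul, hm.avg_const]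
    rfl
  have hest := ha s (fun j => if j = i then 2 else 0) (by
    intro j _ τ
    by_cases hji : j = i
    · subst hji
      simp only [hs, spin_flip_self, if_true]
      rw [sub_neg_eq_add, ← two_mul, abs_mul, abs_spin]
      norm_num
    · simp only [hs, if_neg hji]
      rw [spin_flip_of_ne (fun h => hji h.symm), sub_self, abs_zero])
  rw [hus, ← he, ← hMdef] at hest
  have hsum : ∑ j ∈ Λ, a j * (if j = i then (2 : ℝ) else 0) = a i * 2 := by
    simp [hi]
  rw [hsum, show c * e + d - M * e = d * V by rw [hMe, hV]; ring] at hest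
  refine (hm.ent_le u hu0).trans ?_
  rw [huM, hu2, show c ^ 2 + d ^ 2 + 2 * c * d * e - M ^ 2 = d ^ 2 * V by rw [hMe, hV]; ring,
    div_le_div_iff₀ hM hβ0]
  have h1 : (d * V) ^ 2 ≤ (M * (a i * 2)) ^ 2 := sq_le_sq' (abs_le.1 hest).1 (abs_le.1 hest).2
  have h2 : d ^ 2 * V * (4 * β) ≤ d ^ 2 * V * V :=
    mul_le_mul_of_nonneg_left hVβ (mul_nonneg (sq_nonneg _) hV0.le)
  nlinarith

/-- Approximate tensorization of the entropy. -/
theorem ent_le_sum_condExp (hw : ∀ σ, 0 < w σ) {C : Matrix (Fin n) (Fin n) ℝ} {β ρ : ℝ}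
    (hC : Influence w C) (hC0 : ∀ i j, 0 ≤ C i j) (hsymm : ∀ i j, C i j = C j i)
    (hρ : 0 < ρ) (hrow : ∀ i, ∑ j, C i j ≤ 1 - ρ) (hβ0 : 0 < β)
    (hβ : ∀ i σ, β ≤ flipProb w i σ * (1 - flipProb w i σ))
    {f : Config n → ℝ} (hf : ∀ σ, 0 < f σ) (Λ : Finset (Fin n)) (σ : Config n) :
    ent (kernel w Λ σ) f ≤ (β * ρ ^ 2)⁻¹ *
      ∑ i ∈ Λ, condExp w Λ (fun τ => resid w f i τ ^ 2 / condExp w {i} f τ) σ := by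
  induction hk : Λ.card generalizing Λ σ with
  | zero =>
    rw [Finset.card_eq_zero] at hk
    subst hk
    have h0 : fiber ∅ σ = {σ} := by
      ext τ
      simp [mem_fiber, funext_iff]
    have h1 : ∀ g : Config n → ℝ, avg (kernel w ∅ σ) g = g σ := by
      intro g
      have := (hw σ).ne'
      simp [avg, kernel, h0, this]
    simp [ent, h1]
  | succ k ih =>
    have hm := kernel_isProb hw Λ σ
    set K := (β * ρ ^ 2)⁻¹ with hK
    set M := condExp w Λ f σ with hM
    have hM0 : 0 < M := hm.avg_pos hf
    set G : Fin n → ℝ :=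
      fun i => condExp w Λ (fun τ => resid w f i τ ^ 2 / condExp w {i} f τ) σ with hG
    obtain ⟨a, ha0, ha, hab⟩ := exists_isEstimate_le hw hC hC0 Λ hf σ
    have hsq := sum_sq_le_of_le_add Λ hρ hC0 hsymm
      (fun i => (Finset.sum_le_univ_sum_of_nonneg (hC0 i)).trans (hrow i)) ha0 hab
    have hb : ∀ i ∈ Λ, M * (condExp w Λ (resid w f i) σ / M) ^ 2 ≤ G i := by
      intro i hi
      have h1 := hm.sq_avg_le (resid w f i) (condExp w {i} f)
        fun τ => (kernel_isProb hw _ τ).avg_pos hf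
      have h2 : avg (kernel w Λ σ) (condExp w {i} f) = M :=
        condExp_condExp hw (Finset.singleton_subset_iff.2 hi) f σ
      rw [h2] at h1
      rw [div_pow, mul_div_assoc', div_le_iff₀ (by positivity)]
      calc M * condExp w Λ (resid w f i) σ ^ 2 ≤ M * (G i * M) :=
            mul_le_mul_of_nonneg_left h1 hM0.le
        _ = G i * M ^ 2 := by ring
    have hMa : ∑ i ∈ Λ, M * a i ^ 2 / β ≤ K * ∑ i ∈ Λ, G i := by
      rw [← Finset.sum_div, ← Finset.mul_sum]
      have h1 := mul_le_mul_of_nonneg_left hsq hM0.le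
      rw [mul_div_assoc', Finset.mul_sum, Finset.mul_sum] at h1
      have h2 := Finset.sum_le_sum hb
      rw [← Finset.mul_sum] at h1
      rw [hK, mul_inv, div_eq_inv_mul, mul_assoc]
      refine mul_le_mul_of_nonneg_left (h1.trans ?_) (by positivity)
      rw [div_eq_inv_mul]
      exact mul_le_mul_of_nonneg_left h2 (by positivity)
    have hstep : ∀ i ∈ Λ, ent (kernel w Λ σ) f ≤
        K * ∑ j ∈ Λ.erase i, G j + M * a i ^ 2 / β := by
      intro i hi
      have hsub := Finset.erase_subset i Λ
      rw [ent_eq_condExp_add hw hsub f σ]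
      refine add_le_add ?_ (ent_condExp_erase_le hw hβ0 hβ hf ha hi)
      have hcard : (Λ.erase i).card = k := by rw [Finset.card_erase_of_mem hi, hk]; rfl
      refine (hm.avg_mono fun τ _ => ih (Λ.erase i) τ hcard).trans (le_of_eq ?_)
      rw [avg_const_mul, avg_sum]
      congr 1
      exact Finset.sum_congr rfl fun j _ => condExp_condExp hw hsub _ σ
    have hsum := Finset.sum_le_sum hstep
    rw [Finset.sum_const, Finset.sum_add_distrib, ← Finset.mul_sum, nsmul_eq_mul, hk] at hsum
    have hdouble : ∑ i ∈ Λ, ∑ j ∈ Λ.erase i, G j = k * ∑ j ∈ Λ, G j := by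
      have : ∀ i ∈ Λ, ∑ j ∈ Λ.erase i, G j = ∑ j ∈ Λ, G j - G i := fun i hi =>
        eq_sub_of_add_eq (Finset.sum_erase_add Λ G hi)
      rw [Finset.sum_congr rfl this, Finset.sum_sub_distrib, Finset.sum_const, nsmul_eq_mul, hk]
      push_cast
      ring
    rw [hdouble] at hsum
    push_cast at hsum
    have hk0 : (0 : ℝ) < k + 1 := by positivity
    refine le_of_mul_le_mul_left ?_ hk0
    linarith

lemma resid_sq_div_le (hw : ∀ σ, 0 < w σ) (g : Config n → ℝ) (i : Fin n) (σ : Config n) :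
    resid w (fun τ => Real.exp (g τ)) i σ ^ 2 / condExp w {i} (fun τ => Real.exp (g τ)) σ ≤
      condExp w {i} (fun τ => max (g τ - g (flip i τ)) 0 ^ 2 * Real.exp (g τ)) σ := by
  have hE : 0 < condExp w {i} (fun τ => Real.exp (g τ)) σ :=
    (kernel_isProb hw _ σ).avg_pos fun τ => Real.exp_pos _
  rw [div_le_iff₀ hE, resid, condExp_singleton hw, condExp_singleton hw, flip_flip]
  have aux : ∀ p x y : ℝ, 0 < p → p < 1 → y ≤ x →
      (p * (1 - p) * |Real.exp x - Real.exp y|) ^ 2 ≤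
        ((1 - p) * ((x - y) ^ 2 * Real.exp x)) * ((1 - p) * Real.exp x + p * Real.exp y) := by
    intro p x y hp0 hp1 hxy
    have hx := Real.exp_pos x
    have hy := Real.exp_pos y
    have h1 : Real.exp x - Real.exp y ≤ Real.exp x * (x - y) := by
      have h2 := Real.add_one_le_exp (y - x)
      have h3 : Real.exp y = Real.exp x * Real.exp (y - x) := by
        rw [← Real.exp_add]; congr 1; ring
      nlinarith
    have h0 : 0 ≤ Real.exp x - Real.exp y := sub_nonneg.2 (Real.exp_le_exp.2 hxy)
    rw [abs_of_nonneg h0]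
    have h2 : (Real.exp x - Real.exp y) ^ 2 ≤ (Real.exp x * (x - y)) ^ 2 :=
      pow_le_pow_left₀ h0 h1 2
    have hq : 0 < 1 - p := by linarith
    have hp2 : p ^ 2 ≤ 1 := by nlinarith
    calc (p * (1 - p) * (Real.exp x - Real.exp y)) ^ 2
        = p ^ 2 * ((1 - p) ^ 2 * (Real.exp x - Real.exp y) ^ 2) := by ring
      _ ≤ 1 * ((1 - p) ^ 2 * (Real.exp x * (x - y)) ^ 2) :=
          mul_le_mul hp2 (mul_le_mul_of_nonneg_left h2 (sq_nonneg _)) (by positivity) zero_le_one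
      _ = ((1 - p) * ((x - y) ^ 2 * Real.exp x)) * ((1 - p) * Real.exp x) := by ring
      _ ≤ _ := mul_le_mul_of_nonneg_left (by nlinarith) (by positivity)
  have hp0 := flipProb_pos hw i σ
  have hp1 := flipProb_lt_one hw i σ
  rcases le_total (g (flip i σ)) (g σ) with h | h
  · rw [max_eq_left (sub_nonneg.2 h), max_eq_right (sub_nonpos.2 h)]
    refine (aux _ _ _ hp0 hp1 h).trans (le_of_eq ?_)
    ring
  · rw [max_eq_left (sub_nonneg.2 h), max_eq_right (sub_nonpos.2 h)]
    have := aux (1 - flipProb w i σ) _ _ (by linarith) (by linarith) h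
    rw [abs_sub_comm]
    refine le_trans (le_of_eq ?_) (this.trans (le_of_eq ?_)) <;> ring

/-- A modified logarithmic Sobolev inequality. -/
theorem ent_exp_le (hw : ∀ σ, 0 < w σ) {C : Matrix (Fin n) (Fin n) ℝ} {β ρ : ℝ}
    (hC : Influence w C) (hC0 : ∀ i j, 0 ≤ C i j) (hsymm : ∀ i j, C i j = C j i)
    (hρ : 0 < ρ) (hrow : ∀ i, ∑ j, C i j ≤ 1 - ρ) (hβ0 : 0 < β)
    (hβ : ∀ i σ, β ≤ flipProb w i σ * (1 - flipProb w i σ))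
    (g : Config n → ℝ) (Λ : Finset (Fin n)) (σ : Config n) :
    ent (kernel w Λ σ) (fun τ => Real.exp (g τ)) ≤ (β * ρ ^ 2)⁻¹ *
      avg (kernel w Λ σ)
        (fun τ => (∑ i ∈ Λ, max (g τ - g (flip i τ)) 0 ^ 2) * Real.exp (g τ)) := by
  refine (ent_le_sum_condExp hw hC hC0 hsymm hρ hrow hβ0 hβ
    (fun τ => Real.exp_pos (g τ)) Λ σ).trans ?_
  refine mul_le_mul_of_nonneg_left ?_ (by positivity)
  simp only [Finset.sum_mul]
  rw [avg_sum]
  refine Finset.sum_le_sum fun i hi => ?_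
  refine ((kernel_isProb hw Λ σ).avg_mono fun τ _ => resid_sq_div_le hw g i τ).trans
    (le_of_eq ?_)
  exact condExp_condExp hw (Finset.singleton_subset_iff.2 hi) _ σ

end Entropy


section Model

variable {n : ℕ}

lemma spin_flip (i : Fin n) (σ : Config n) :
    spin (flip i σ) = spin σ - Pi.single i (2 * spin σ i) := by
  ext j
  by_cases h : j = i
  · subst h
    rw [spin_flip_self, Pi.sub_apply, Pi.single_eq_same]
    ring
  · rw [spin_flip_of_ne h, Pi.sub_apply, Pi.single_eq_of_ne h, sub_zero]

lemma mulVec_spin_flip (A : Matrix (Fin n) (Fin n) ℝ) (i : Fin n) (σ : Config n) (k : Fin n) :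
    (A *ᵥ spin (flip i σ)) k = (A *ᵥ spin σ) k - 2 * A k i * spin σ i := by
  rw [spin_flip, Matrix.mulVec_sub, Pi.sub_apply, Matrix.mulVec_single]
  simp
  ring

lemma quadForm_flip {A : Matrix (Fin n) (Fin n) ℝ} (hA : A.IsSymm) (i : Fin n)
    (h0 : A i i = 0) (σ : Config n) :
    quadForm A (flip i σ) = quadForm A σ - 4 * (spin σ i * (A *ᵥ spin σ) i) := by
  have h1 : spin σ ⬝ᵥ (A *ᵥ Pi.single i (2 * spin σ i)) =
      (A *ᵥ spin σ) i * (2 * spin σ i) := by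
    rw [Matrix.dotProduct_mulVec, dotProduct_single, ← Matrix.mulVec_transpose, hA.eq]
  have h2 : (A *ᵥ Pi.single i (2 * spin σ i)) i = 0 := by
    rw [Matrix.mulVec_single]
    simp [h0]
  rw [quadForm, quadForm, spin_flip, Matrix.mulVec_sub, sub_dotProduct, dotProduct_sub,
    dotProduct_sub, single_dotProduct, single_dotProduct, h1, h2]
  ring

/-- The local field at `i`. -/
def localField (J : Matrix (Fin n) (Fin n) ℝ) (h : Fin n → ℝ) (σ : Config n) (i : Fin n) : ℝ :=
  (J *ᵥ spin σ) i - h i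

variable {J : Matrix (Fin n) (Fin n) ℝ} {h : Fin n → ℝ}

lemma weight_pos (J : Matrix (Fin n) (Fin n) ℝ) (h : Fin n → ℝ) (σ : Config n) :
    0 < weight J h σ := Real.exp_pos _

lemma weight_eq (J : Matrix (Fin n) (Fin n) ℝ) (h : Fin n → ℝ) (σ : Config n) :
    weight J h σ = Real.exp (1 / 2 * quadForm J σ - h ⬝ᵥ spin σ) := by
  have : ∑ i, ∑ j, J i j * spin σ i * spin σ j = quadForm J σ := by
    simp only [quadForm, dotProduct, Matrix.mulVec, Finset.mul_sum]
    exact Finset.sum_congr rfl fun i _ => Finset.sum_congr rfl fun j _ => by ring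
  rw [weight, this]
  rfl

lemma weight_flip (hJ : J.IsSymm) (hJ0 : ∀ i, J i i = 0) (i : Fin n) (σ : Config n) :
    weight J h (flip i σ) =
      weight J h σ * Real.exp (-(2 * (spin σ i * localField J h σ i))) := by
  rw [weight_eq, weight_eq, ← Real.exp_add, quadForm_flip hJ i (hJ0 i), spin_flip,
    dotProduct_sub, dotProduct_single, localField]
  congr 1
  ring

lemma flipProb_weight (hJ : J.IsSymm) (hJ0 : ∀ i, J i i = 0) (i : Fin n) (σ : Config n) :
    flipProb (weight J h) i σ =
      (1 + Real.exp (2 * (spin σ i * localField J h σ i)))⁻¹ := by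
  rw [flipProb, weight_flip hJ hJ0, Real.exp_neg]
  have h1 := weight_pos J h σ
  have h2 := Real.exp_pos (2 * (spin σ i * localField J h σ i))
  field_simp
  rw [add_comm]

lemma abs_inv_one_add_exp_sub_le (x y : ℝ) :
    |(1 + Real.exp x)⁻¹ - (1 + Real.exp y)⁻¹| ≤ |x - y| / 4 := by
  have hd : ∀ z : ℝ, HasDerivAt (fun z : ℝ => (1 + Real.exp z)⁻¹)
      (-Real.exp z / (1 + Real.exp z) ^ 2) z := fun z =>
    ((Real.hasDerivAt_exp z).const_add 1).inv (by positivity)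
  have := Convex.norm_image_sub_le_of_norm_hasDerivWithin_le
    (f := fun z : ℝ => (1 + Real.exp z)⁻¹) (C := 1 / 4) (s := Set.univ)
    (fun z _ => (hd z).hasDerivWithinAt) (fun z _ => by
      have hz := Real.exp_pos z
      rw [Real.norm_eq_abs, neg_div, abs_neg, abs_of_pos (by positivity),
        div_le_div_iff₀ (by positivity) (by norm_num)]
      nlinarith [sq_nonneg (1 - Real.exp z)]) convex_univ (Set.mem_univ y) (Set.mem_univ x)
  rw [Real.norm_eq_abs, Real.norm_eq_abs] at this
  linarith

lemma influence_weight (hJ : J.IsSymm) (hJ0 : ∀ i, J i i = 0) :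
    Influence (weight J h) fun i j => |J i j| := by
  intro i j hij σ
  rw [flipProb_weight hJ hJ0, flipProb_weight hJ hJ0]
  refine (abs_inv_one_add_exp_sub_le _ _).trans (le_of_eq ?_)
  rw [spin_flip_of_ne hij, localField, localField, mulVec_spin_flip,
    show 2 * (spin σ i * ((J *ᵥ spin σ) i - h i)) -
      2 * (spin σ i * ((J *ᵥ spin σ) i - 2 * J i j * spin σ j - h i)) =
      4 * spin σ i * spin σ j * J i j by ring, abs_mul, abs_mul, abs_mul, abs_spin, abs_spin]
  norm_num

lemma sum_abs_le_norm11 (J : Matrix (Fin n) (Fin n) ℝ) (i : Fin n) :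
    ∑ j, |J i j| ≤ norm11 J :=
  le_ciSup (f := fun i => ∑ j, |J i j|) (Set.finite_range _).bddAbove i

lemma abs_localField_le {α : ℝ} (hh : ‖h‖ ≤ α) (hJ : norm11 J ≤ 1) (σ : Config n) (i : Fin n) :
    |localField J h σ i| ≤ 1 + α := by
  have h1 : |(J *ᵥ spin σ) i| ≤ 1 := by
    rw [Matrix.mulVec, dotProduct]
    refine (Finset.abs_sum_le_sum_abs _ _).trans ?_
    simp only [abs_mul, abs_spin, mul_one]
    exact (sum_abs_le_norm11 J i).trans hJ
  have h2 : |h i| ≤ α := (norm_le_pi_norm h i).trans hh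
  exact (abs_sub _ _).trans (add_le_add h1 h2)

lemma le_flipProb_weight_mul {α : ℝ} (hJ : J.IsSymm) (hJ0 : ∀ i, J i i = 0) (hh : ‖h‖ ≤ α)
    (hJ1 : norm11 J ≤ 1) (i : Fin n) (σ : Config n) :
    (1 + Real.exp (2 * (1 + α)))⁻¹ ^ 2 ≤
      flipProb (weight J h) i σ * (1 - flipProb (weight J h) i σ) := by
  have key : ∀ τ, (1 + Real.exp (2 * (1 + α)))⁻¹ ≤ flipProb (weight J h) i τ := by
    intro τ
    rw [flipProb_weight hJ hJ0]
    gcongr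
    refine (le_abs_self _).trans ?_
    rw [abs_mul, abs_spin, one_mul]
    exact abs_localField_le hh hJ1 τ i
  rw [← flipProb_flip (weight_pos J h), sq]
  have : 0 ≤ (1 + Real.exp (2 * (1 + α)))⁻¹ := by positivity
  exact mul_le_mul (key _) (key _) this (this.trans (key _))

lemma mass_eq_kernel (J : Matrix (Fin n) (Fin n) ℝ) (h : Fin n → ℝ) (σ : Config n) :
    mass J h = kernel (weight J h) Finset.univ σ := by
  have : fiber Finset.univ σ = Finset.univ := by
    ext τ
    simp [mem_fiber]
  ext τ
  simp [mass, kernel, this, partitionFunction]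

lemma mass_isProb (J : Matrix (Fin n) (Fin n) ℝ) (h : Fin n → ℝ) : IsProb (mass J h) := by
  rw [mass_eq_kernel J h 1]
  exact kernel_isProb (weight_pos J h) _ _

/-- The constant in the modified logarithmic Sobolev inequality for the Ising model. -/
noncomputable def sobolevConst (α ρ : ℝ) : ℝ :=
  ((1 + Real.exp (2 * (1 + α)))⁻¹ ^ 2 * ρ ^ 2)⁻¹

lemma sobolevConst_pos {α ρ : ℝ} (hρ : 0 < ρ) : 0 < sobolevConst α ρ := by
  unfold sobolevConst
  positivity

/-- The modified logarithmic Sobolev inequality under Dobrushin's condition. -/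
theorem ent_mass_exp_le {α ρ : ℝ} (hρ : 0 < ρ) (hJ : J.IsSymm) (hJ0 : ∀ i, J i i = 0)
    (hh : ‖h‖ ≤ α) (hJρ : norm11 J ≤ 1 - ρ) (g : Config n → ℝ) :
    ent (mass J h) (fun τ => Real.exp (g τ)) ≤ sobolevConst α ρ *
      avg (mass J h) (fun τ => (∑ i, max (g τ - g (flip i τ)) 0 ^ 2) * Real.exp (g τ)) := by
  rw [mass_eq_kernel J h 1]
  refine ent_exp_le (weight_pos J h) (influence_weight hJ hJ0) (fun i j => abs_nonneg _)
    (fun i j => by rw [← hJ.apply i j]) hρ (fun i => (sum_abs_le_norm11 J i).trans hJρ)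
    (by positivity) (le_flipProb_weight_mul hJ hJ0 hh (by linarith)) g Finset.univ 1

end Model


section Herbst

variable {Ω : Type*} [Fintype Ω] {m : Ω → ℝ}

lemma hasDerivAt_avg_exp (m f : Ω → ℝ) (l : ℝ) :
    HasDerivAt (fun l => avg m fun x => Real.exp (l * f x))
      (avg m fun x => f x * Real.exp (l * f x)) l := by
  unfold avg
  refine HasDerivAt.fun_sum fun x _ => ?_
  have := (((hasDerivAt_id l).mul_const (f x)).exp).const_mul (m x)
  simp only [id, one_mul] at this
  beta_reduce
  rwa [mul_comm (f x)]

lemma ent_exp_eq (m f : Ω → ℝ) (l : ℝ) :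
    ent m (fun x => Real.exp (l * f x)) = l * avg m (fun x => f x * Real.exp (l * f x)) -
      avg m (fun x => Real.exp (l * f x)) * Real.log (avg m fun x => Real.exp (l * f x)) := by
  rw [ent, ← avg_const_mul]
  congr 2
  ext x
  rw [Real.log_exp]
  ring

/-- Herbst's argument. -/
lemma IsProb.log_avg_exp_le (hm : IsProb m) (f : Ω → ℝ) {l₀ V B : ℝ}
    (h : ∀ l, 0 < l → l ≤ l₀ → ent m (fun x => Real.exp (l * f x)) ≤
      l ^ 2 * (V * avg m (fun x => Real.exp (l * f x)) +
        B * avg m fun x => f x * Real.exp (l * f x))) {l : ℝ} (hl : 0 < l) (hl₀ : l ≤ l₀) :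
    Real.log (avg m fun x => Real.exp (l * f x)) * (1 / l - B) ≤ avg m f + V * l := by
  set M : ℝ → ℝ := fun l => avg m fun x => Real.exp (l * f x) with hM
  set M' : ℝ → ℝ := fun l => avg m fun x => f x * Real.exp (l * f x) with hM'
  have hM0 : ∀ l, 0 < M l := fun l => hm.avg_pos fun x => Real.exp_pos _
  have hφ : ∀ l, HasDerivAt (fun l => Real.log (M l)) (M' l / M l) l := fun l =>
    (hasDerivAt_avg_exp m f l).log (hM0 l).ne'
  set H : ℝ → ℝ := fun l => Real.log (M l) / l - B * Real.log (M l) - V * l with hH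
  have hHd : ∀ l, 0 < l → HasDerivAt H
      ((M' l / M l * l - Real.log (M l) * 1) / l ^ 2 - B * (M' l / M l) - V * 1) l :=
    fun l hl => (((hφ l).div (hasDerivAt_id l) hl.ne').sub ((hφ l).const_mul B)).sub
      ((hasDerivAt_id l).const_mul V)
  have hanti : AntitoneOn H (Set.Ioc 0 l₀) := by
    refine antitoneOn_of_deriv_nonpos (convex_Ioc 0 l₀)
      (fun x hx => (hHd x hx.1).continuousAt.continuousWithinAt)
      (fun x hx => ?_) fun x hx => ?_
    · rw [interior_Ioc] at hx
      exact (hHd x hx.1).differentiableAt.differentiableWithinAt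
    · rw [interior_Ioc] at hx
      rw [(hHd x hx.1).deriv]
      have h1 := h x hx.1 hx.2.le
      rw [ent_exp_eq] at h1
      change x * M' x - M x * Real.log (M x) ≤ x ^ 2 * (V * M x + B * M' x) at h1
      have hx0 := hx.1
      have hMx := hM0 x
      have e : (M' x / M x * x - Real.log (M x) * 1) / x ^ 2 - B * (M' x / M x) - V * 1 =
          (x * M' x - M x * Real.log (M x) - x ^ 2 * (V * M x + B * M' x)) / (x ^ 2 * M x) := by
        field_simp
        ring
      rw [e]
      exact div_nonpos_of_nonpos_of_nonneg (by linarith) (by positivity)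
  have hlim : Filter.Tendsto H (nhdsWithin 0 (Set.Ioi 0)) (nhds (avg m f - B * 0 - V * 0)) := by
    have hφ0 : Real.log (M 0) = 0 := by simp [hM, hm.avg_const]
    have hM'0 : M' 0 / M 0 = avg m f := by simp [hM, hM', hm.avg_const]
    refine Filter.Tendsto.sub (Filter.Tendsto.sub ?_ ?_) ?_
    · have := (hφ 0).tendsto_slope_zero_right
      rw [hM'0] at this
      refine this.congr fun x => ?_
      rw [zero_add, hφ0, sub_zero, smul_eq_mul, div_eq_inv_mul]
    · have := (hφ 0).continuousAt.tendsto.const_mul B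
      rw [hφ0] at this
      exact this.mono_left nhdsWithin_le_nhds
    · exact (Filter.tendsto_id.const_mul V).mono_left nhdsWithin_le_nhds
  have hle : H l ≤ avg m f - B * 0 - V * 0 := by
    refine ge_of_tendsto hlim ?_
    filter_upwards [Ioc_mem_nhdsGT hl] with x hx
    exact hanti ⟨hx.1, hx.2.trans hl₀⟩ ⟨hl, hl₀⟩ hx.2
  have e : H l = Real.log (M l) * (1 / l - B) - V * l := by
    simp only [hH]
    ring
  rw [e] at hle
  linarith

end Herbst

section Concentration

variable {n : ℕ} {m : Config n → ℝ} {K : ℝ}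

/-- The sum of the squared decreases of `g` under reversing one spin. -/
noncomputable def gradSq (g : Config n → ℝ) (τ : Config n) : ℝ :=
  ∑ i, max (g τ - g (flip i τ)) 0 ^ 2

/-- A modified logarithmic Sobolev inequality with constant `K`. -/
def ModifiedLogSobolev (m : Config n → ℝ) (K : ℝ) : Prop :=
  ∀ g : Config n → ℝ, ent m (fun τ => Real.exp (g τ)) ≤
    K * avg m (fun τ => gradSq g τ * Real.exp (g τ))

lemma gradSq_const_mul {l : ℝ} (hl : 0 ≤ l) (g : Config n → ℝ) (τ : Config n) :
    gradSq (fun τ => l * g τ) τ = l ^ 2 * gradSq g τ := by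
  rw [gradSq, gradSq, Finset.mul_sum]
  refine Finset.sum_congr rfl fun i _ => ?_
  rw [← mul_pow, mul_max_of_nonneg _ _ hl, mul_zero, mul_sub]

lemma gradSq_sq_le {g : Config n → ℝ} (hg : ∀ τ, 0 ≤ g τ) (τ : Config n) :
    gradSq (fun τ => g τ ^ 2) τ ≤ 4 * g τ ^ 2 * gradSq g τ := by
  rw [gradSq, gradSq, Finset.mul_sum]
  refine Finset.sum_le_sum fun i _ => ?_
  have h0 := hg τ
  have h1 := hg (flip i τ)
  rw [show 4 * g τ ^ 2 * max (g τ - g (flip i τ)) 0 ^ 2 =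
    (2 * g τ * max (g τ - g (flip i τ)) 0) ^ 2 by ring]
  refine pow_le_pow_left₀ (le_max_right _ _) (max_le ?_ (by positivity)) 2
  rcases le_total (g (flip i τ)) (g τ) with h | h
  · rw [max_eq_left (sub_nonneg.2 h)]
    nlinarith
  · refine le_trans ?_ (mul_nonneg (by positivity) (le_max_right _ _))
    nlinarith

lemma ModifiedLogSobolev.ent_const_mul_le (hm : IsProb m) (hK : 0 < K)
    (hS : ModifiedLogSobolev m K) {f b : Config n → ℝ} (hb : ∀ τ, gradSq f τ ≤ b τ) {l : ℝ}
    (hl : 0 ≤ l) :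
    ent m (fun τ => Real.exp (l * f τ)) ≤
      K * l ^ 2 * avg m (fun τ => b τ * Real.exp (l * f τ)) := by
  refine (hS fun τ => l * f τ).trans ?_
  rw [mul_assoc, ← avg_const_mul (l ^ 2)]
  refine mul_le_mul_of_nonneg_left (hm.avg_mono fun τ _ => ?_) hK.le
  rw [gradSq_const_mul hl, mul_assoc]
  exact mul_le_mul_of_nonneg_left
    (mul_le_mul_of_nonneg_right (hb τ) (Real.exp_pos _).le) (sq_nonneg l)

lemma ModifiedLogSobolev.avg_sq_le (hm : IsProb m) (hK : 0 < K)
    (hS : ModifiedLogSobolev m K) {g : Config n → ℝ} {s : ℝ} (hs : 0 < s)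
    (hg0 : ∀ τ, 0 ≤ g τ) (hg : ∀ τ, gradSq g τ ≤ 4 * s ^ 2) :
    avg m (fun τ => g τ ^ 2) ≤ 2 * avg m g ^ 2 + 4 * Real.exp (4 * K) * s ^ 2 := by
  set μ := avg m g with hμ
  have hμ0 : 0 ≤ μ := hm.avg_nonneg hg0
  have h1 := hm.log_avg_exp_le g (l₀ := s⁻¹) (V := 4 * K * s ^ 2) (B := 0) (fun l hl _ => by
    refine (hS.ent_const_mul_le hm hK hg hl.le).trans (le_of_eq ?_)
    rw [avg_const_mul]
    ring) (inv_pos.2 hs) le_rfl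
  have hpos : 0 < avg m fun τ => Real.exp (s⁻¹ * g τ) := hm.avg_pos fun τ => Real.exp_pos _
  have h2 : Real.log (avg m fun τ => Real.exp (s⁻¹ * g τ)) ≤ 4 * K + s⁻¹ * μ := by
    rw [one_div, inv_inv, sub_zero] at h1
    have h3 := mul_le_mul_of_nonneg_right h1 (inv_pos.2 hs).le
    rw [mul_assoc, mul_inv_cancel₀ hs.ne', mul_one] at h3
    refine h3.trans (le_of_eq ?_)
    field_simp
    ring
  rw [Real.log_le_iff_le_exp hpos] at h2
  have h3 : avg m (fun τ => g τ ^ 2) ≤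
      avg m (fun τ => 2 * μ ^ 2 + 4 * s ^ 2 * Real.exp (-(s⁻¹ * μ)) * Real.exp (s⁻¹ * g τ)) := by
    refine hm.avg_mono fun τ _ => ?_
    rw [mul_assoc, ← Real.exp_add, ← sub_eq_neg_add, ← mul_sub]
    rcases le_total (g τ) μ with h | h
    · have := Real.exp_pos (s⁻¹ * (g τ - μ))
      have := mul_self_le_mul_self (hg0 τ) h
      have h5 : 0 ≤ 4 * s ^ 2 * Real.exp (s⁻¹ * (g τ - μ)) := by positivity
      nlinarith [sq_nonneg μ]
    · have hx : 0 ≤ s⁻¹ * (g τ - μ) := mul_nonneg (inv_pos.2 hs).le (sub_nonneg.2 h)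
      have h4 := Real.quadratic_le_exp_of_nonneg hx
      have h5 : (s⁻¹ * (g τ - μ)) ^ 2 / 2 ≤ Real.exp (s⁻¹ * (g τ - μ)) := by linarith
      have h6 := mul_le_mul_of_nonneg_left h5 (by positivity : 0 ≤ 4 * s ^ 2)
      have h7 : 4 * s ^ 2 * ((s⁻¹ * (g τ - μ)) ^ 2 / 2) = 2 * (g τ - μ) ^ 2 := by
        field_simp
        ring
      nlinarith [sq_nonneg (g τ - 2 * μ)]
  rw [avg_add, hm.avg_const, avg_const_mul] at h3
  refine h3.trans (add_le_add_right ?_ _)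
  refine (mul_le_mul_of_nonneg_left h2 (by positivity)).trans (le_of_eq ?_)
  rw [Real.exp_add, Real.exp_neg]
  have := Real.exp_pos (s⁻¹ * μ)
  field_simp

lemma ModifiedLogSobolev.log_avg_exp_sq_le (hm : IsProb m) (hK : 0 < K)
    (hS : ModifiedLogSobolev m K) {g : Config n → ℝ} {s : ℝ} (hs : 0 < s)
    (hg0 : ∀ τ, 0 ≤ g τ) (hg : ∀ τ, gradSq g τ ≤ 4 * s ^ 2) :
    Real.log (avg m fun τ => Real.exp ((32 * K * s ^ 2)⁻¹ * g τ ^ 2)) ≤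
      2 * (32 * K * s ^ 2)⁻¹ * avg m (fun τ => g τ ^ 2) := by
  have hb : ∀ τ, gradSq (fun τ => g τ ^ 2) τ ≤ (16 * s ^ 2) * g τ ^ 2 := fun τ => by
    refine (gradSq_sq_le hg0 τ).trans ?_
    refine (mul_le_mul_of_nonneg_left (hg τ) (by positivity)).trans (le_of_eq ?_)
    ring
  have h1 := hm.log_avg_exp_le (fun τ => g τ ^ 2) (l₀ := (32 * K * s ^ 2)⁻¹) (V := 0)
    (B := 16 * K * s ^ 2) (fun l hl _ => by
    refine (hS.ent_const_mul_le hm hK hb hl.le).trans (le_of_eq ?_)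
    simp only [mul_assoc (16 * s ^ 2)]
    rw [avg_const_mul]
    ring) (by positivity) le_rfl
  rw [one_div, inv_inv, zero_mul, add_zero,
    show 32 * K * s ^ 2 - 16 * K * s ^ 2 = 16 * K * s ^ 2 by ring] at h1
  rw [show 2 * (32 * K * s ^ 2)⁻¹ * avg m (fun τ => g τ ^ 2) =
    avg m (fun τ => g τ ^ 2) / (16 * K * s ^ 2) by field_simp; ring,
    le_div_iff₀ (by positivity)]
  exact h1

/-- Exponential moments of a function whose gradient is controlled by a Lipschitz function. -/
lemma ModifiedLogSobolev.log_avg_exp_le (hm : IsProb m) (hK : 0 < K)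
    (hS : ModifiedLogSobolev m K) {f g : Config n → ℝ} {s : ℝ} (hs : 0 < s)
    (hg0 : ∀ τ, 0 ≤ g τ) (hg : ∀ τ, gradSq g τ ≤ 4 * s ^ 2)
    (hf : ∀ τ, gradSq f τ ≤ 16 * g τ ^ 2) {l : ℝ} (hl : 0 < l) (hl' : l ≤ (32 * K * s)⁻¹) :
    Real.log (avg m fun τ => Real.exp (l * f τ)) ≤
      l * avg m f + 64 * K * avg m (fun τ => g τ ^ 2) * l ^ 2 := by
  set Q := avg m (fun τ => g τ ^ 2) with hQ
  have h1 := hm.log_avg_exp_le f (l₀ := (32 * K * s)⁻¹) (V := 64 * K * Q) (B := 0)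
    (fun l hl hl' => by
      have hA := hS.ent_const_mul_le hm hK hf hl.le
      simp only [mul_assoc (16 : ℝ)] at hA
      rw [avg_const_mul] at hA
      have hB := hm.avg_mul_le_ent (fun τ => (32 * K * s ^ 2)⁻¹ * g τ ^ 2)
        (fun τ => Real.exp (l * f τ)) fun τ => Real.exp_pos _
      simp only [mul_assoc (32 * K * s ^ 2)⁻¹] at hB
      rw [avg_const_mul] at hB
      have hY : 0 < avg m fun τ => Real.exp (l * f τ) := hm.avg_pos fun τ => Real.exp_pos _
      have hX : 0 ≤ avg m fun τ => g τ ^ 2 * Real.exp (l * f τ) :=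
        hm.avg_nonneg fun τ => by positivity
      have hC := mul_le_mul_of_nonneg_left (hS.log_avg_exp_sq_le hm hK hs hg0 hg) hY.le
      rw [← hQ] at hC
      set X := avg m fun τ => g τ ^ 2 * Real.exp (l * f τ)
      set Y := avg m fun τ => Real.exp (l * f τ)
      set E := ent m fun τ => Real.exp (l * f τ)
      have hl2 : l * (32 * K * s) ≤ 1 := by
        have := mul_le_mul_of_nonneg_right hl' (by positivity : 0 ≤ 32 * K * s)
        rwa [inv_mul_cancel₀ (by positivity)] at this
      have hl3 : (l * (32 * K * s)) ^ 2 ≤ 1 := pow_le_one₀ (by positivity) hl2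
      have hD : X ≤ (32 * K * s ^ 2) * E + 2 * Q * Y := by
        have h2 : (32 * K * s ^ 2)⁻¹ * X ≤ E + Y * (2 * (32 * K * s ^ 2)⁻¹ * Q) := by linarith
        have h3 := mul_le_mul_of_nonneg_left h2 (by positivity : 0 ≤ 32 * K * s ^ 2)
        rw [← mul_assoc, mul_inv_cancel₀ (by positivity), one_mul] at h3
        refine h3.trans (le_of_eq ?_)
        field_simp
      have hF : (32 * K * s ^ 2) * E ≤ X / 2 := by
        have h2 := mul_le_mul_of_nonneg_left hA (by positivity : 0 ≤ 32 * K * s ^ 2)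
        have h3 := mul_le_mul_of_nonneg_right hl3 hX
        nlinarith
      have hG : X ≤ 4 * Q * Y := by linarith
      refine hA.trans ?_
      have h2 := mul_le_mul_of_nonneg_left hG (by positivity : 0 ≤ K * l ^ 2 * 16)
      nlinarith) hl hl'
  rw [sub_zero] at h1
  have h2 := mul_le_mul_of_nonneg_right h1 hl.le
  rw [mul_assoc, one_div, inv_mul_cancel₀ hl.ne', mul_one] at h2
  refine h2.trans (le_of_eq ?_)
  ring

/-- The constant in the concentration inequality, given the constant `K` in the modified
logarithmic Sobolev inequality. -/
noncomputable def concentrationConst (K : ℝ) : ℝ :=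
  (256 * K * (2 + 4 * Real.exp (4 * K)))⁻¹

lemma concentrationConst_pos (hK : 0 < K) : 0 < concentrationConst K := by
  unfold concentrationConst
  positivity

open Classical in
theorem ModifiedLogSobolev.tail_le (hm : IsProb m) (hK : 0 < K)
    (hS : ModifiedLogSobolev m K) {f g : Config n → ℝ} {s : ℝ} (hs : 0 < s)
    (hg0 : ∀ τ, 0 ≤ g τ) (hg : ∀ τ, gradSq g τ ≤ 4 * s ^ 2)
    (hf : ∀ τ, gradSq f τ ≤ 16 * g τ ^ 2) {t : ℝ} (ht : 0 < t) :
    (∑ τ, if t ≤ f τ - avg m f then m τ else 0) ≤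
      Real.exp (-concentrationConst K * min (t ^ 2 / (avg m g + s) ^ 2) (t / s)) := by
  set D := 2 + 4 * Real.exp (4 * K) with hD
  have hD0 : 2 < D := by
    have := Real.exp_pos (4 * K)
    linarith
  have hμ0 : 0 ≤ avg m g := hm.avg_nonneg hg0
  set V := 64 * K * (D * (avg m g + s) ^ 2) with hV
  have hV0 : 0 < V := by positivity
  have hQV : 64 * K * avg m (fun τ => g τ ^ 2) ≤ V := by
    refine mul_le_mul_of_nonneg_left ((hS.avg_sq_le hm hK hs hg0 hg).trans ?_) (by positivity)
    have he := Real.exp_pos (4 * K)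
    have h1 : avg m g ^ 2 ≤ (avg m g + s) ^ 2 := pow_le_pow_left₀ hμ0 (by linarith) 2
    have h2 : s ^ 2 ≤ (avg m g + s) ^ 2 := pow_le_pow_left₀ hs.le (by linarith) 2
    have h3 := mul_le_mul_of_nonneg_left h2 (by positivity : 0 ≤ 4 * Real.exp (4 * K))
    rw [hD, add_mul]
    linarith
  set l := min (t / (2 * V)) (32 * K * s)⁻¹ with hl
  have hl0 : 0 < l := lt_min (by positivity) (by positivity)
  have hlog := hS.log_avg_exp_le hm hK hs hg0 hg hf hl0 (min_le_right _ _)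
  have hpos : 0 < avg m fun τ => Real.exp (l * f τ) := hm.avg_pos fun τ => Real.exp_pos _
  rw [Real.log_le_iff_le_exp hpos] at hlog
  have hchern : (∑ τ, if t ≤ f τ - avg m f then m τ else 0) ≤
      Real.exp (-(l * (avg m f + t))) * avg m (fun τ => Real.exp (l * f τ)) := by
    rw [← avg_const_mul]
    refine Finset.sum_le_sum fun τ _ => ?_
    beta_reduce
    rw [← Real.exp_add]
    split_ifs with h
    · refine le_mul_of_one_le_right (hm.nonneg τ) (Real.one_le_exp ?_)
      nlinarith
    · exact mul_nonneg (hm.nonneg τ) (Real.exp_pos _).le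
  refine hchern.trans ((mul_le_mul_of_nonneg_left hlog (Real.exp_pos _).le).trans ?_)
  rw [← Real.exp_add, Real.exp_le_exp]
  have h1 : 64 * K * avg m (fun τ => g τ ^ 2) * l ^ 2 ≤ l * t / 2 := by
    have h2 : l * V ≤ t / 2 := by
      have := mul_le_mul_of_nonneg_right (min_le_left (t / (2 * V)) (32 * K * s)⁻¹) hV0.le
      refine this.trans (le_of_eq ?_)
      field_simp
    have h3 := mul_le_mul_of_nonneg_right hQV (sq_nonneg l)
    nlinarith
  have h2 : concentrationConst K * min (t ^ 2 / (avg m g + s) ^ 2) (t / s) ≤ l * t / 2 := by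
    have hc := concentrationConst_pos hK
    have h3 : l * t / 2 = min (t / (2 * V) * (t / 2)) ((32 * K * s)⁻¹ * (t / 2)) := by
      rw [← min_mul_of_nonneg _ _ (by positivity : 0 ≤ t / 2)]
      ring
    rw [h3]
    refine le_min ?_ ?_
    · refine (mul_le_mul_of_nonneg_left (min_le_left _ _) hc.le).trans (le_of_eq ?_)
      rw [concentrationConst, ← hD, hV]
      have : 0 < avg m g + s := by linarith
      field_simp
      norm_num
    · refine (mul_le_mul_of_nonneg_left (min_le_right _ _) hc.le).trans ?_
      rw [concentrationConst, ← hD,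
        show (256 * K * D)⁻¹ * (t / s) = t / (256 * K * D * s) by field_simp,
        show (32 * K * s)⁻¹ * (t / 2) = t / (64 * K * s) by field_simp; norm_num]
      refine div_le_div_of_nonneg_left ht.le (by positivity) ?_
      have : 0 < K * s := by positivity
      nlinarith
  linarith

end Concentration


section Suprema

variable {n : ℕ}

lemma imageNorm_nonneg (A : Matrix (Fin n) (Fin n) ℝ) (σ : Config n) : 0 ≤ imageNorm A σ :=
  norm_nonneg _

lemma opNorm_nonneg (A : Matrix (Fin n) (Fin n) ℝ) : 0 ≤ opNorm A := norm_nonneg _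

lemma imageNorm_sq (A : Matrix (Fin n) (Fin n) ℝ) (σ : Config n) :
    imageNorm A σ ^ 2 = ∑ i, (A *ᵥ spin σ) i ^ 2 :=
  EuclideanSpace.real_norm_sq_eq _

lemma sum_mulVec_sq_le (A : Matrix (Fin n) (Fin n) ℝ) (v : Fin n → ℝ) :
    ∑ i, (A *ᵥ v) i ^ 2 ≤ opNorm A ^ 2 * ‖WithLp.toLp 2 v‖ ^ 2 := by
  have h := (Matrix.toEuclideanCLM (𝕜 := ℝ) A).le_opNorm (WithLp.toLp 2 v)
  rw [Matrix.toEuclideanCLM_toLp] at h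
  have h2 := pow_le_pow_left₀ (norm_nonneg _) h 2
  rw [EuclideanSpace.real_norm_sq_eq, mul_pow] at h2
  exact h2

lemma gradSq_sup'_quadForm_le {𝒜 : Finset (Matrix (Fin n) (Fin n) ℝ)} (h𝒜 : 𝒜.Nonempty)
    (hA : ∀ A ∈ 𝒜, A.IsSymm ∧ ∀ i, A i i = 0) (σ : Config n) :
    gradSq (fun σ => 𝒜.sup' h𝒜 fun A => quadForm A σ) σ ≤
      16 * (𝒜.sup' h𝒜 fun A => imageNorm A σ) ^ 2 := by
  obtain ⟨A, hA𝒜, hAσ⟩ := Finset.exists_mem_eq_sup' h𝒜 fun A => quadForm A σ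
  obtain ⟨hsymm, hdiag⟩ := hA A hA𝒜
  have h1 : gradSq (fun σ => 𝒜.sup' h𝒜 fun A => quadForm A σ) σ ≤ 16 * imageNorm A σ ^ 2 := by
    rw [imageNorm_sq, Finset.mul_sum]
    refine Finset.sum_le_sum fun i _ => ?_
    have h2 : quadForm A (flip i σ) ≤ 𝒜.sup' h𝒜 fun A => quadForm A (flip i σ) :=
      Finset.le_sup' (fun A => quadForm A (flip i σ)) hA𝒜
    rw [quadForm_flip hsymm i (hdiag i)] at h2
    beta_reduce
    rw [hAσ, show 16 * (A *ᵥ spin σ) i ^ 2 = |4 * (spin σ i * (A *ᵥ spin σ) i)| ^ 2 by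
      rw [sq_abs, mul_pow, mul_pow, spin_sq]; ring]
    refine pow_le_pow_left₀ (le_max_right _ _) (max_le ?_ (abs_nonneg _)) 2
    exact le_trans (by linarith) (le_abs_self _)
  have h3 : imageNorm A σ ≤ 𝒜.sup' h𝒜 fun A => imageNorm A σ :=
    Finset.le_sup' (fun A => imageNorm A σ) hA𝒜
  have h4 := pow_le_pow_left₀ (imageNorm_nonneg A σ) h3 2
  linarith

lemma imageNorm_mul_sub_le {A : Matrix (Fin n) (Fin n) ℝ} (hA : A.IsSymm) (i : Fin n)
    (σ : Config n) :
    imageNorm A σ * (imageNorm A σ - imageNorm A (flip i σ)) ≤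
      2 * spin σ i * (A *ᵥ (A *ᵥ spin σ)) i := by
  have h1 : inner ℝ (WithLp.toLp 2 (A *ᵥ spin σ)) (WithLp.toLp 2 (A *ᵥ spin (flip i σ))) =
      imageNorm A σ ^ 2 - 2 * spin σ i * (A *ᵥ (A *ᵥ spin σ)) i := by
    rw [EuclideanSpace.inner_toLp_toLp, star_trivial, spin_flip, Matrix.mulVec_sub,
      sub_dotProduct, imageNorm_sq]
    congr 1
    · simp only [dotProduct, sq]
    · rw [dotProduct_comm, Matrix.dotProduct_mulVec, dotProduct_single,
        ← Matrix.mulVec_transpose, hA.eq]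
      ring
  have h2 := real_inner_le_norm (WithLp.toLp 2 (A *ᵥ spin σ))
    (WithLp.toLp 2 (A *ᵥ spin (flip i σ)))
  rw [h1] at h2
  change _ ≤ imageNorm A σ * imageNorm A (flip i σ) at h2
  linarith

lemma gradSq_sup'_imageNorm_le {𝒜 : Finset (Matrix (Fin n) (Fin n) ℝ)} (h𝒜 : 𝒜.Nonempty)
    (hA : ∀ A ∈ 𝒜, A.IsSymm) (σ : Config n) :
    gradSq (fun σ => 𝒜.sup' h𝒜 fun A => imageNorm A σ) σ ≤ 4 * (𝒜.sup' h𝒜 opNorm) ^ 2 := by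
  obtain ⟨A, hA𝒜, hAσ⟩ := Finset.exists_mem_eq_sup' h𝒜 fun A => imageNorm A σ
  have hop : opNorm A ≤ 𝒜.sup' h𝒜 opNorm := Finset.le_sup' opNorm hA𝒜
  have hop2 := pow_le_pow_left₀ (opNorm_nonneg A) hop 2
  have hflip : ∀ i, imageNorm A (flip i σ) ≤ 𝒜.sup' h𝒜 fun A => imageNorm A (flip i σ) :=
    fun i => Finset.le_sup' (fun A => imageNorm A (flip i σ)) hA𝒜
  refine le_trans ?_ (mul_le_mul_of_nonneg_left hop2 (by norm_num))
  rcases (imageNorm_nonneg A σ).eq_or_lt with h0 | h0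
  · have : gradSq (fun σ => 𝒜.sup' h𝒜 fun A => imageNorm A σ) σ = 0 := by
      refine Finset.sum_eq_zero fun i _ => ?_
      beta_reduce
      rw [hAσ, max_eq_right, sq, mul_zero]
      linarith [hflip i, imageNorm_nonneg A (flip i σ)]
    rw [this]
    positivity
  · have h1 : imageNorm A σ ^ 2 * gradSq (fun σ => 𝒜.sup' h𝒜 fun A => imageNorm A σ) σ ≤
        4 * ∑ i, (A *ᵥ (A *ᵥ spin σ)) i ^ 2 := by
      rw [gradSq, Finset.mul_sum, Finset.mul_sum]
      refine Finset.sum_le_sum fun i _ => ?_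
      rw [hAσ, ← mul_pow, mul_max_of_nonneg _ _ h0.le, mul_zero,
        show 4 * (A *ᵥ (A *ᵥ spin σ)) i ^ 2 =
          |2 * spin σ i * (A *ᵥ (A *ᵥ spin σ)) i| ^ 2 by
        rw [sq_abs, mul_pow, mul_pow, spin_sq]; ring]
      refine pow_le_pow_left₀ (le_max_right _ _) (max_le ?_ (abs_nonneg _)) 2
      refine le_trans ?_ ((imageNorm_mul_sub_le (hA A hA𝒜) i σ).trans (le_abs_self _))
      exact mul_le_mul_of_nonneg_left (by linarith [hflip i]) h0.le
    have h2 := sum_mulVec_sq_le A (A *ᵥ spin σ)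
    change _ ≤ opNorm A ^ 2 * imageNorm A σ ^ 2 at h2
    refine le_of_mul_le_mul_left ?_ (pow_pos h0 2)
    linarith

lemma prob_le_one (J : Matrix (Fin n) (Fin n) ℝ) (h : Fin n → ℝ) (S : Set (Config n)) :
    prob J h S ≤ 1 := by
  classical
  rw [← (mass_isProb J h).sum_eq_one, prob]
  refine Finset.sum_le_sum fun σ _ => ?_
  split_ifs
  · exact le_rfl
  · exact (mass_isProb J h).nonneg σ

end Suprema

end Ising

theorem mainTheorem7 (α ρ : ℝ) (hρ : 0 < ρ) :
    ∃ C : ℝ, 0 < C ∧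
      ∀ (n : ℕ) (J : Matrix (Fin n) (Fin n) ℝ) (h : Fin n → ℝ),
        J.IsSymm → (∀ i, J i i = 0) → ‖h‖ ≤ α → Ising.norm11 J ≤ 1 - ρ →
        ∀ (𝒜 : Finset (Matrix (Fin n) (Fin n) ℝ)) (h𝒜 : 𝒜.Nonempty),
          (∀ A ∈ 𝒜, A.IsSymm ∧ ∀ i, A i i = 0) →
          ∀ t : ℝ, 0 ≤ t →
            Ising.prob J h
                {σ | t ≤ 𝒜.sup' h𝒜 (fun A => Ising.quadForm A σ) -
                  Ising.expect J h (fun τ => 𝒜.sup' h𝒜 (fun A => Ising.quadForm A τ))} ≤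
              Real.exp (-C * min
                (t ^ 2 /
                  (Ising.expect J h (fun τ => 𝒜.sup' h𝒜 (fun A => Ising.imageNorm A τ)) +
                    𝒜.sup' h𝒜 Ising.opNorm) ^ 2)
                (t / 𝒜.sup' h𝒜 Ising.opNorm)) := by
  have hK := Ising.sobolevConst_pos (α := α) hρ
  refine ⟨Ising.concentrationConst (Ising.sobolevConst α ρ), Ising.concentrationConst_pos hK,
    fun n J h hJ hJ0 hh hJρ 𝒜 h𝒜 hA t ht => ?_⟩
  have hm := Ising.mass_isProb J h
  have hS : Ising.ModifiedLogSobolev (Ising.mass J h) (Ising.sobolevConst α ρ) :=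
    Ising.ent_mass_exp_le hρ hJ hJ0 hh hJρ
  obtain ⟨A, hA𝒜⟩ := h𝒜
  have hs0 : 0 ≤ 𝒜.sup' ⟨A, hA𝒜⟩ Ising.opNorm :=
    (Ising.opNorm_nonneg A).trans (Finset.le_sup' Ising.opNorm hA𝒜)
  rcases hs0.eq_or_lt with hs | hs
  · rw [← hs, div_zero, min_eq_right (by positivity), mul_zero, Real.exp_zero]
    exact Ising.prob_le_one J h _
  rcases ht.eq_or_lt with rfl | ht
  · rw [zero_div, sq, mul_zero, zero_div, min_self, mul_zero, Real.exp_zero]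
    exact Ising.prob_le_one J h _
  exact hS.tail_le hm hK hs
    (fun τ => (Ising.imageNorm_nonneg A τ).trans
      (Finset.le_sup' (fun A => Ising.imageNorm A τ) hA𝒜))
    (Ising.gradSq_sup'_imageNorm_le ⟨A, hA𝒜⟩ fun A hA' => (hA A hA').1)
    (Ising.gradSq_sup'_quadForm_le ⟨A, hA𝒜⟩ hA) ht
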